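/- Let $A\in\mathbb R^{n\times n}$ be stable (all its eigenvalues have negative real part), $B\in\mathbb R^{n\times m}$, $C\in\mathbb R^{p\times n}$, and $G(s)=C(sI_n-A)^{-1}B$. Let $\tilde J\in\mathrm{Skew}(n)$, $\tilde R\in\mathrm{Sym}_+(n)$, $\tilde B\in\mathbb R^{n\times m}$, $\tilde C\in\mathbb R^{p\times n}$ be such that the system $(\tilde J-\tilde R,\tilde B,\tilde C)$ is obtained from $(A,B,C)$ by an invertible change of state coordinates $T$, i.e. $TA=(\tilde J-\tilde R)T$, $\tilde B=TB$, $C=\tilde CT$. Here $\mathrm{Skew}(k)$ and $\mathrm{Sym}_+(k)$ are the real skew-symmetric and the real symmetric positive definite $k\times k$ matrices, $\mathrm{sym}(M)=\frac12(M+M^T)$ and $\mathrm{sk}(M)=\frac12(M-M^T)$. On the manifold $M=\mathrm{Skew}(r)\times \mathrm{Sym}_+(r)\times\mathbb R^{r\times m}\times\mathbb R^{p\times r}$ consider $$f(J_r,R_r,B_r,C_r)=\|G-G_r\|_{H^2}^2=\frac1{2\pi}\int_{-\infty}^{\infty}\|G(i\omega)-G_r(i\omega)\|_F^2\,d\omega,\qquad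 G_r(s)=C_r\bigl(sI_r-(J_r-R_r)\bigr)^{-1}B_r,$$ and the Riemannian metric $$\langle(\xi_1,\eta_1,\zeta_1,\kappa_1),(\xi_2,\eta_2,\zeta_2,\kappa_2)\rangle_{(J_r,R_r,B_r,C_r)}=\mathrm{tr}(\xi_1^T\xi_2)+\mathrm{tr}(R_r^{-1}\eta_1R_r^{-1}\eta_2)+\mathrm{tr}(\zeta_1^T\zeta_2)+\mathrm{tr}(\kappa_1^T\kappa_2).$$ Then $f$ is smooth on $M$, and at every point $(J_r,R_r,B_r,C_r)\in M$ the integral defining $f$ is finite and the following holds. With $A_r:=J_r-R_r$ and $\tilde A:=\tilde J-\tilde R$, the equations $$A_rP+PA_r^T+B_rB_r^T=0,\quad A_r^TQ+QA_r+C_r^TC_r=0,\quad \tilde AX+XA_r^T+\tilde BB_r^T=0,\quad \tilde A^TY+YA_r-\tilde C^TC_r=0$$ have unique solutions $P,Q\in\mathbb R^{r\times r}$, $X,Y\in\mathbb R^{n\times r}$, and the Riemannian gradient is $$\mathrm{grad} f=\bigl(2\,\mathrm{sk}(QP+Y^TX),\ -2R_r\,\mathrm{sym}(QP+Y^TX)R_r,\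 2(QB_r+Y^T\tilde B),\ 2(C_rP-\tilde CX)\bigr).$$ Moreover, for every tangent vector $(J_r',R_r',B_r',C_r')\in\mathrm{Skew}(r)\times\mathrm{Sym}(r)\times\mathbb R^{r\times m}\times\mathbb R^{p\times r}$, where $\mathrm{Sym}(r)$ is the space of real symmetric $r\times r$ matrices, the differentiated equations, with $A_r':=J_r'-R_r'$, $$A_rP'+P'A_r^T+A_r'P+PA_r'^T+B_r'B_r^T+B_rB_r'^T=0,\qquad A_r^TQ'+Q'A_r+A_r'^TQ+QA_r'+C_r'^TC_r+C_r^TC_r'=0,$$ $$\tilde AX'+X'A_r^T+XA_r'^T+\tilde BB_r'^T=0,\qquad \tilde A^TY'+Y'A_r+YA_r'-\tilde C^TC_r'=0$$ have unique solutions $P',Q',X',Y'$, and the Riemannian Hessian (the Levi-Civita covariant derivative of $\mathrm{grad} f$) is $$\mathrm{Hess} f[(J_r',R_r',B_r',C_r')]=\Bigl(2\,\mathrm{sk}(N),\ -2R_r\,\mathrm{sym}(N)R_r-2\,\mathrm{sym}\bigl(R_r'\,\mathrm{sym}(QP+Y^TX)R_r\bigr),\ 2(Q'B_r+QB_r'+Y'^T\tilde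 B),\ 2(C_r'P+C_rP'-\tilde CX')\Bigr),$$ where $N:=Q'P+QP'+Y'^TX+Y^TX'$. -/

import Mathlib

open Matrix MeasureTheory
open scoped ContDiff

open scoped MatrixOrder in
theorem exists_eq_transpose_mul_self {r : ℕ} {S : Matrix (Fin r) (Fin r) ℝ} (hS : S.PosSemidef) :
    ∃ D : Matrix (Fin r) (Fin r) ℝ, S = Dᵀ * D := by
  obtain ⟨D, hD⟩ := CStarAlgebra.nonneg_iff_eq_star_mul_self.mp hS.nonneg
  exact ⟨D, by rw [hD, star_eq_conjTranspose, conjTranspose_eq_transpose_of_trivial]⟩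

-- Matrix spaces are finite-dimensional real vector spaces; the entrywise sup norm is used only to
-- speak about derivatives and smoothness, which do not depend on the choice of the norm.
attribute [local instance] Matrix.normedAddCommGroup Matrix.normedSpace

noncomputable section

/-! ### Riemannian geometry on an open subset of a finite-dimensional vector space

An open subset `U` of a vector space `E` is a manifold with one global chart, and every tangent
space of it is `E`. -/

/-- A smooth Riemannian metric on the open subset `U` of `E`. -/
structure RiemannianMetricOn {E : Type*} [NormedAddCommGroup E] [NormedSpace ℝ E]
    (U : Set E) where
  isOpen : IsOpen U
  form : E → E →L[ℝ] E →L[ℝ] ℝ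
  symm : ∀ x ∈ U, ∀ v w : E, form x v w = form x w v
  pos : ∀ x ∈ U, ∀ v : E, v ≠ 0 → 0 < form x v v
  smooth : ContDiffOn ℝ ∞ form U

namespace RiemannianMetricOn

variable {E : Type*} [NormedAddCommGroup E] [NormedSpace ℝ E] {U : Set E}

/-- The vector that represents the covector `ℓ` with respect to the inner product at `x`. -/
def sharp (g : RiemannianMetricOn U) (x : E) (ℓ : E →L[ℝ] ℝ) : E :=
  (g.form x).inverse ℓ

/-- At the points of `U` the vector `g.sharp x ℓ` is determined by `⟨g.sharp x ℓ, w⟩ₓ = ℓ w`. -/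
theorem eq_sharp_iff [FiniteDimensional ℝ E] (g : RiemannianMetricOn U) {x : E} (hx : x ∈ U)
    (ℓ : E →L[ℝ] ℝ) (v : E) : v = g.sharp x ℓ ↔ ∀ w, g.form x v w = ℓ w := by
  have hinj : Function.Injective (g.form x : E →ₗ[ℝ] E →L[ℝ] ℝ) := by
    rw [← LinearMap.ker_eq_bot, LinearMap.ker_eq_bot']
    intro u hu
    by_contra hne
    have h1 := g.pos x hx u hne
    have h2 : g.form x u = 0 := hu
    simp [h2] at h1
  have hdim : Module.finrank ℝ E = Module.finrank ℝ (E →L[ℝ] ℝ) := by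
    rw [← (LinearMap.toContinuousLinearMap (𝕜 := ℝ) (E := E) (F' := ℝ)).finrank_eq]
    exact (Subspace.dual_finrank_eq (K := ℝ) (V := E)).symm
  let e : E ≃L[ℝ] (E →L[ℝ] ℝ) :=
    (LinearEquiv.ofInjectiveOfFinrankEq (g.form x : E →ₗ[ℝ] E →L[ℝ] ℝ)
      hinj hdim).toContinuousLinearEquiv
  have he : (e : E →L[ℝ] (E →L[ℝ] ℝ)) = g.form x := by
    ext u w
    rfl
  have hs : g.sharp x ℓ = e.symm ℓ := by
    rw [sharp, ← he, ContinuousLinearMap.inverse_equiv]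
    rfl
  rw [hs, ← he]
  constructor
  · rintro rfl w
    simp
  · intro h
    rw [ContinuousLinearEquiv.eq_symm_apply]
    ext w
    exact h w

/-- The Riemannian gradient: `⟨grad f (x), w⟩ₓ = D f (x)[w]` for every tangent vector `w`. -/
def grad (g : RiemannianMetricOn U) (f : E → ℝ) (x : E) : E :=
  g.sharp x (fderiv ℝ f x)

/-- The Christoffel map `Γ` of the metric, given by the Koszul formula
`2 ⟨Γ(u, v), w⟩ₓ = D_u ⟨v, w⟩ + D_v ⟨u, w⟩ - D_w ⟨u, v⟩` for constant fields `u`, `v`, `w`. -/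
def christoffel (g : RiemannianMetricOn U) (x u v : E) : E :=
  (1 / 2 : ℝ) • g.sharp x
    (fderiv ℝ g.form x u v + fderiv ℝ g.form x v u
      - ((fderiv ℝ g.form x).flip u).flip v)

/-- The Levi-Civita connection: `(∇_v X)(x) = D X (x)[v] + Γₓ(v, X(x))`. -/
def leviCivita (g : RiemannianMetricOn U) (X : E → E) (x v : E) : E :=
  fderiv ℝ X x v + g.christoffel x v (X x)

theorem fderiv_form_symm (g : RiemannianMetricOn U) {x : E} (hx : x ∈ U) (u v w : E) :
    fderiv ℝ g.form x w u v = fderiv ℝ g.form x w v u := by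
  have hd : DifferentiableAt ℝ g.form x :=
    ((g.smooth x hx).contDiffAt (g.isOpen.mem_nhds hx)).differentiableAt (by simp)
  have hc : ∀ a b : E, HasFDerivAt (fun y => g.form y a b)
      (((fderiv ℝ g.form x).flip a).flip b) x := fun a b =>
    (hd.hasFDerivAt.clm_apply (hasFDerivAt_const a x)).clm_apply (hasFDerivAt_const b x)
      |>.congr_fderiv (by ext z; simp)
  have he : (fun y => g.form y u v) =ᶠ[nhds x] fun y => g.form y v u := by
    filter_upwards [g.isOpen.mem_nhds hx] with y hy using g.symm y hy u v
  have := ((hc v u).congr_of_eventuallyEq he).unique (hc u v)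
  exact (congrArg (fun L : E →L[ℝ] ℝ => L w) this).symm

/-- The connection is torsion-free: `∇_X Y - ∇_Y X = [X, Y]`. -/
theorem leviCivita_torsionFree (g : RiemannianMetricOn U) {x : E} (hx : x ∈ U) (X Y : E → E) :
    g.leviCivita Y x (X x) - g.leviCivita X x (Y x) = VectorField.lieBracket ℝ X Y x := by
  have hG : g.christoffel x (X x) (Y x) = g.christoffel x (Y x) (X x) := by
    unfold christoffel
    congr 2
    ext w
    simp [g.fderiv_form_symm hx (X x) (Y x) w, add_comm]
  simp [leviCivita, hG, VectorField.lieBracket]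

/-- The connection is compatible with the metric:
`D_v ⟨X, Y⟩ = ⟨∇_v X, Y⟩ + ⟨X, ∇_v Y⟩`. -/
theorem leviCivita_metric [FiniteDimensional ℝ E] (g : RiemannianMetricOn U) {x : E} (hx : x ∈ U)
    {X Y : E → E} (hX : DifferentiableAt ℝ X x) (hY : DifferentiableAt ℝ Y x) (v : E) :
    fderiv ℝ (fun y => g.form y (X y) (Y y)) x v
      = g.form x (g.leviCivita X x v) (Y x) + g.form x (X x) (g.leviCivita Y x v) := by
  have hd : DifferentiableAt ℝ g.form x :=
    ((g.smooth x hx).contDiffAt (g.isOpen.mem_nhds hx)).differentiableAt (by simp)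
  have key := fun u v w : E => g.fderiv_form_symm hx u v w
  have hsharp : ∀ (ℓ : E →L[ℝ] ℝ) (w : E), g.form x (g.sharp x ℓ) w = ℓ w := fun ℓ w =>
    (g.eq_sharp_iff hx ℓ _).1 rfl w
  have hG : ∀ a b w : E, g.form x (g.christoffel x a b) w = (1 / 2 : ℝ) *
      (fderiv ℝ g.form x a b w + fderiv ℝ g.form x b a w - fderiv ℝ g.form x w a b) := by
    intro a b w
    simp [christoffel, hsharp]
  rw [((hd.hasFDerivAt.clm_apply hX.hasFDerivAt).clm_apply hY.hasFDerivAt).fderiv]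
  simp only [leviCivita, map_add, _root_.add_apply]
  rw [g.symm x hx (X x) (g.christoffel x v (Y x)), hG, hG, key (Y x) (X x) v, key v (X x) (Y x),
    key v (Y x) (X x)]
  simp
  ring

/-- The Riemannian Hessian `Hess f (x)[v] = (∇_v grad f)(x)`. -/
def hess (g : RiemannianMetricOn U) (f : E → ℝ) (x v : E) : E :=
  g.leviCivita (g.grad f) x v

end RiemannianMetricOn

/-! ### The product manifold `Skew(r) × Sym₊(r) × ℝ^{r×m} × ℝ^{p×r}` -/

/-- The vector space of skew-symmetric matrices. -/
def SkewMat (r : ℕ) : Submodule ℝ (Matrix (Fin r) (Fin r) ℝ) where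
  carrier := {A | Aᵀ = -A}
  add_mem' {A B} hA hB := by
    simp only [Set.mem_ofPred_eq] at *
    rw [transpose_add, hA, hB]; abel
  zero_mem' := by simp
  smul_mem' c A hA := by
    simp only [Set.mem_ofPred_eq] at *
    rw [transpose_smul, hA, smul_neg]

/-- The vector space of symmetric matrices. -/
def SymMat (r : ℕ) : Submodule ℝ (Matrix (Fin r) (Fin r) ℝ) where
  carrier := {A | Aᵀ = A}
  add_mem' {A B} hA hB := by
    simp only [Set.mem_ofPred_eq] at *
    rw [transpose_add, hA, hB]
  zero_mem' := by simp
  smul_mem' c A hA := by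
    simp only [Set.mem_ofPred_eq] at *
    rw [transpose_smul, hA]

/-- The vector space `Skew(r) × Sym(r) × ℝ^{r×m} × ℝ^{p×r}`: it contains the manifold as an open
subset and is its tangent space at each point. -/
def PHSpace (r m p : ℕ) : Type :=
  SkewMat r × SymMat r × Matrix (Fin r) (Fin m) ℝ × Matrix (Fin p) (Fin r) ℝ

instance (r m p : ℕ) : NormedAddCommGroup (PHSpace r m p) :=
  inferInstanceAs (NormedAddCommGroup
    (SkewMat r × SymMat r × Matrix (Fin r) (Fin m) ℝ × Matrix (Fin p) (Fin r) ℝ))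

instance (r m p : ℕ) : NormedSpace ℝ (PHSpace r m p) :=
  inferInstanceAs (NormedSpace ℝ
    (SkewMat r × SymMat r × Matrix (Fin r) (Fin m) ℝ × Matrix (Fin p) (Fin r) ℝ))

instance (r m p : ℕ) : FiniteDimensional ℝ (PHSpace r m p) :=
  inferInstanceAs (FiniteDimensional ℝ
    (SkewMat r × SymMat r × Matrix (Fin r) (Fin m) ℝ × Matrix (Fin p) (Fin r) ℝ))

namespace PHSpace

variable {r m p : ℕ}

/-- The skew-symmetric component. -/
def J (x : PHSpace r m p) : Matrix (Fin r) (Fin r) ℝ := (Prod.fst x : SkewMat r)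

/-- The symmetric component. -/
def R (x : PHSpace r m p) : Matrix (Fin r) (Fin r) ℝ := (Prod.fst (Prod.snd x) : SymMat r)

/-- The input matrix component. -/
def B (x : PHSpace r m p) : Matrix (Fin r) (Fin m) ℝ := Prod.fst (Prod.snd (Prod.snd x))

/-- The output matrix component. -/
def C (x : PHSpace r m p) : Matrix (Fin p) (Fin r) ℝ := Prod.snd (Prod.snd (Prod.snd x))

@[ext]
theorem ext {x y : PHSpace r m p} (hJ : x.J = y.J) (hR : x.R = y.R) (hB : x.B = y.B)
    (hC : x.C = y.C) : x = y :=
  Prod.ext (Subtype.ext hJ) (Prod.ext (Subtype.ext hR) (Prod.ext hB hC))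

@[simp] theorem J_add (x y : PHSpace r m p) : (x + y).J = x.J + y.J := rfl

@[simp] theorem R_add (x y : PHSpace r m p) : (x + y).R = x.R + y.R := rfl

@[simp] theorem B_add (x y : PHSpace r m p) : (x + y).B = x.B + y.B := rfl

@[simp] theorem C_add (x y : PHSpace r m p) : (x + y).C = x.C + y.C := rfl

@[simp] theorem J_smul (c : ℝ) (x : PHSpace r m p) : (c • x).J = c • x.J := rfl

@[simp] theorem R_smul (c : ℝ) (x : PHSpace r m p) : (c • x).R = c • x.R := rfl

@[simp] theorem B_smul (c : ℝ) (x : PHSpace r m p) : (c • x).B = c • x.B := rfl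

@[simp] theorem C_smul (c : ℝ) (x : PHSpace r m p) : (c • x).C = c • x.C := rfl

theorem transpose_R (x : PHSpace r m p) : x.Rᵀ = x.R := (Prod.fst (Prod.snd x) : SymMat r).2

theorem contDiff_R : ContDiff ℝ ∞ (R : PHSpace r m p → Matrix (Fin r) (Fin r) ℝ) :=
  ((SymMat r).subtypeL.contDiff).comp
    ((contDiff_fst (E := SymMat r)
      (F := Matrix (Fin r) (Fin m) ℝ × Matrix (Fin p) (Fin r) ℝ)).comp
      (contDiff_snd (E := SkewMat r)))

end PHSpace

/-- The manifold `M = Skew(r) × Sym₊(r) × ℝ^{r×m} × ℝ^{p×r}`. -/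
def PHManifold (r m p : ℕ) : Set (PHSpace r m p) := {x | x.R.PosDef}

/-- The bilinear form `tr(ξ₁ᵀξ₂) + tr(R⁻¹η₁R⁻¹η₂) + tr(ζ₁ᵀζ₂) + tr(κ₁ᵀκ₂)` at `x = (J, R, B, C)`. -/
def phForm {r m p : ℕ} (x : PHSpace r m p) :
    PHSpace r m p →L[ℝ] PHSpace r m p →L[ℝ] ℝ :=
  LinearMap.toContinuousBilinearMap (LinearMap.mk₂ ℝ
    (fun v w : PHSpace r m p =>
      (v.Jᵀ * w.J).trace + (x.R⁻¹ * v.R * x.R⁻¹ * w.R).trace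
        + (v.Bᵀ * w.B).trace + (v.Cᵀ * w.C).trace)
    (by
      intro a b c
      simp [Matrix.add_mul, Matrix.mul_add]
      ring)
    (by
      intro k a b
      simp
      ring)
    (by
      intro a b c
      simp [Matrix.mul_add]
      ring)
    (by
      intro k a b
      simp
      ring))

theorem phForm_apply {r m p : ℕ} (x v w : PHSpace r m p) :
    phForm x v w = (v.Jᵀ * w.J).trace + (x.R⁻¹ * v.R * x.R⁻¹ * w.R).trace
        + (v.Bᵀ * w.B).trace + (v.Cᵀ * w.C).trace := rfl

theorem isOpen_phManifold (r m p : ℕ) : IsOpen (PHManifold r m p) := by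
  have hset : PHManifold r m p = {x | ∀ v ∈ Metric.sphere (0 : Fin r → ℝ) 1,
      0 < v ⬝ᵥ (x.R *ᵥ v)} := by
    ext x
    simp only [PHManifold, Set.mem_ofPred_eq, posDef_iff_dotProduct_mulVec]
    constructor
    · rintro ⟨-, h⟩ v hv
      have := h (x := v) (by rintro rfl; simp at hv)
      simpa using this
    · intro h
      refine ⟨by simpa [IsHermitian, conjTranspose_eq_transpose_of_trivial] using x.transpose_R, ?_⟩
      intro v hv
      have hn : 0 < ‖v‖ := norm_pos_iff.2 hv
      have h1 := h (‖v‖⁻¹ • v) (by simp [norm_smul, hn.ne'])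
      simp only [mulVec_smul, dotProduct_smul, smul_dotProduct, smul_eq_mul] at h1
      have h2 : 0 < ‖v‖⁻¹ := inv_pos.2 hn
      simpa using pos_of_mul_pos_right (pos_of_mul_pos_right h1 h2.le) h2.le
  rw [hset, isOpen_iff_eventually]
  intro x hx
  have hc : Continuous fun z : PHSpace r m p × (Fin r → ℝ) => z.2 ⬝ᵥ (z.1.R *ᵥ z.2) :=
    continuous_snd.dotProduct
      ((PHSpace.contDiff_R.continuous.comp continuous_fst).matrix_mulVec continuous_snd)
  refine (isCompact_sphere (0 : Fin r → ℝ) 1).eventually_forall_of_forall_eventually ?_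
  intro v hv
  exact hc.continuousAt.eventually (lt_mem_nhds (hx v hv))

theorem phForm_symm {r m p : ℕ} (x v w : PHSpace r m p) : phForm x v w = phForm x w v := by
  have h : ∀ {a b : ℕ} (S T : Matrix (Fin a) (Fin b) ℝ), (Sᵀ * T).trace = (Tᵀ * S).trace := by
    intro a b S T
    rw [← trace_transpose, transpose_mul, transpose_transpose]
  rw [phForm_apply, phForm_apply, h v.J, h v.B, h v.C, Matrix.mul_assoc (x.R⁻¹ * v.R),
    trace_mul_comm (x.R⁻¹ * v.R), ← Matrix.mul_assoc]

theorem phForm_pos {r m p : ℕ} (x : PHSpace r m p) (hx : x ∈ PHManifold r m p)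
    (v : PHSpace r m p) (hv : v ≠ 0) : 0 < phForm x v v := by
  have hnn : ∀ {a b : ℕ} (S : Matrix (Fin a) (Fin b) ℝ), 0 ≤ (Sᵀ * S).trace := fun S => by
    simpa [conjTranspose_eq_transpose_of_trivial] using
      (posSemidef_conjTranspose_mul_self S).trace_nonneg
  have hz : ∀ {a b : ℕ} (S : Matrix (Fin a) (Fin b) ℝ), (Sᵀ * S).trace = 0 → S = 0 := fun S h => by
    rwa [← conjTranspose_eq_transpose_of_trivial, trace_conjTranspose_mul_self_eq_zero_iff] at h
  have hinv : (x.R⁻¹).PosDef := PosDef.inv hx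
  obtain ⟨D, hD⟩ := exists_eq_transpose_mul_self hinv.posSemidef
  have hDu : IsUnit D := by
    have h1 : IsUnit (Dᵀ * D) := hD ▸ hinv.isUnit
    rw [isUnit_iff_isUnit_det, det_mul] at h1
    rw [isUnit_iff_isUnit_det]
    exact isUnit_of_mul_isUnit_right h1
  have hDt : IsUnit Dᵀ := by
    rw [isUnit_iff_isUnit_det, det_transpose]
    exact (isUnit_iff_isUnit_det D).1 hDu
  have hR : (x.R⁻¹ * v.R * x.R⁻¹ * v.R).trace
      = ((D * v.R * Dᵀ)ᵀ * (D * v.R * Dᵀ)).trace := by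
    rw [hD]
    simp only [transpose_mul, transpose_transpose, v.transpose_R]
    rw [Matrix.mul_assoc, Matrix.mul_assoc, Matrix.mul_assoc, trace_mul_comm]
    simp only [Matrix.mul_assoc]
  rw [phForm_apply, hR]
  have h1 := hnn v.J
  have h2 := hnn (D * v.R * Dᵀ)
  have h3 := hnn v.B
  have h4 := hnn v.C
  by_contra hle
  apply hv
  have hRz : D * v.R * Dᵀ = 0 := hz _ (by linarith)
  have hRz' : v.R = 0 := by
    have h5 : D * v.R = 0 := by
      apply hDt.mul_right_cancel
      rw [hRz, Matrix.zero_mul]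
    apply hDu.mul_left_cancel
    rw [h5, Matrix.mul_zero]
  exact PHSpace.ext (hz _ (by linarith)) hRz' (hz _ (by linarith)) (hz _ (by linarith))

theorem contDiffOn_phForm (r m p : ℕ) :
    ContDiffOn ℝ ∞ (phForm (r := r) (m := m) (p := p)) (PHManifold r m p) := by
  have hentry : ∀ i j, ContDiff ℝ ∞ fun x : PHSpace r m p => x.R i j := fun i j =>
    contDiff_pi.1 (contDiff_pi.1 (PHSpace.contDiff_R (r := r) (m := m) (p := p)) i) j
  have hdet : ∀ F : PHSpace r m p → Matrix (Fin r) (Fin r) ℝ,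
      (∀ i j, ContDiff ℝ ∞ fun x => F x i j) → ContDiff ℝ ∞ fun x => (F x).det := by
    intro F hF
    simp only [det_apply]
    exact ContDiff.sum fun σ _ => (contDiff_prod fun i _ => hF _ _).const_smul _
  have hinv : ∀ i j, ContDiffOn ℝ ∞ (fun x : PHSpace r m p => x.R⁻¹ i j) (PHManifold r m p) := by
    intro i j
    have heq : (fun x : PHSpace r m p => x.R⁻¹ i j) =
        fun x => (x.R.det)⁻¹ * (x.R.adjugate i j) := by
      funext x
      simp [Matrix.inv_def]
    rw [heq]
    refine ContDiffOn.mul ((hdet _ hentry).contDiffOn.inv fun x hx => ?_) (ContDiff.contDiffOn ?_)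
    · exact (PosDef.det_pos hx).ne'
    · simp only [adjugate_apply]
      refine hdet _ fun k l => ?_
      by_cases hk : k = j
      · subst hk
        simpa using contDiff_const
      · simpa [updateRow_ne hk] using hentry k l
  rw [contDiffOn_clm_apply]
  intro v
  rw [contDiffOn_clm_apply]
  intro w
  simp only [phForm_apply]
  refine ((contDiffOn_const.add ?_).add contDiffOn_const).add contDiffOn_const
  simp only [trace, diag_apply, mul_apply]
  refine ContDiffOn.sum fun i _ => ContDiffOn.sum fun j _ => ContDiffOn.mul ?_ contDiffOn_const
  refine ContDiffOn.sum fun k _ => ContDiffOn.mul ?_ (hinv _ _)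
  exact ContDiffOn.sum fun l _ => ContDiffOn.mul (hinv _ _) contDiffOn_const

/-- The product Riemannian metric: Euclidean on the skew-symmetric factor and on the two matrix
factors, affine-invariant on the factor of positive definite matrices. -/
def phMetric (r m p : ℕ) : RiemannianMetricOn (PHManifold r m p) where
  isOpen := isOpen_phManifold r m p
  form := phForm
  symm x _ v w := phForm_symm x v w
  pos x hx v hv := phForm_pos x hx v hv
  smooth := contDiffOn_phForm r m p

/-! ### Linear systems and the objective function -/

/-- `sym(A) = (A + Aᵀ)/2`. -/
def symPart {r : ℕ} (A : Matrix (Fin r) (Fin r) ℝ) : Matrix (Fin r) (Fin r) ℝ :=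
  (1 / 2 : ℝ) • (A + Aᵀ)

/-- `sk(A) = (A - Aᵀ)/2`. -/
def skPart {r : ℕ} (A : Matrix (Fin r) (Fin r) ℝ) : Matrix (Fin r) (Fin r) ℝ :=
  (1 / 2 : ℝ) • (A - Aᵀ)

/-- All (complex) eigenvalues of the real matrix `A` have negative real part. -/
def IsStableMatrix {n : ℕ} (A : Matrix (Fin n) (Fin n) ℝ) : Prop :=
  ∀ μ ∈ spectrum ℂ (A.map Complex.ofReal), μ.re < 0

/-- The transfer function `G(s) = C (s I - A)⁻¹ B`. -/
def transferFunction {n m p : ℕ} (A : Matrix (Fin n) (Fin n) ℝ) (B : Matrix (Fin n) (Fin m) ℝ)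
    (C : Matrix (Fin p) (Fin n) ℝ) (s : ℂ) : Matrix (Fin p) (Fin m) ℂ :=
  C.map Complex.ofReal * (s • (1 : Matrix (Fin n) (Fin n) ℂ) - A.map Complex.ofReal)⁻¹
    * B.map Complex.ofReal

/-- The Frobenius norm `√(tr(A* A))`. -/
def frobNorm {p m : ℕ} (A : Matrix (Fin p) (Fin m) ℂ) : ℝ :=
  Real.sqrt (Aᴴ * A).trace.re

/-- The `H²` norm `√((1/2π) ∫ ‖G(it)‖_F² dt)`. -/
def h2Norm {p m : ℕ} (G : ℂ → Matrix (Fin p) (Fin m) ℂ) : ℝ :=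
  Real.sqrt (1 / (2 * Real.pi) * ∫ t : ℝ, frobNorm (G (Complex.I * t)) ^ 2)

/-- The error transfer function `G - G_r`, where `G` belongs to `(A, B, C)` and `G_r` to the reduced
system `(J_r - R_r, B_r, C_r)`. -/
def errorTransfer {n r m p : ℕ} (A : Matrix (Fin n) (Fin n) ℝ) (B : Matrix (Fin n) (Fin m) ℝ)
    (C : Matrix (Fin p) (Fin n) ℝ) (x : PHSpace r m p) (s : ℂ) : Matrix (Fin p) (Fin m) ℂ :=
  transferFunction A B C s - transferFunction (x.J - x.R) x.B x.C s

/-- The objective function `f(J_r, R_r, B_r, C_r) = ‖G - G_r‖²_{H²}`. -/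
def objective {n r m p : ℕ} (A : Matrix (Fin n) (Fin n) ℝ) (B : Matrix (Fin n) (Fin m) ℝ)
    (C : Matrix (Fin p) (Fin n) ℝ) (x : PHSpace r m p) : ℝ :=
  h2Norm (errorTransfer A B C x) ^ 2

/-- `(Jt - Rt, Bt, Ct)`, with `Jt` skew-symmetric and `Rt` symmetric positive definite, arises from
`(A, B, C)` by an invertible change `T` of the state coordinates. -/
structure IsDissipativeForm {n m p : ℕ} (A : Matrix (Fin n) (Fin n) ℝ)
    (B : Matrix (Fin n) (Fin m) ℝ) (C : Matrix (Fin p) (Fin n) ℝ)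
    (Jt Rt : Matrix (Fin n) (Fin n) ℝ) (Bt : Matrix (Fin n) (Fin m) ℝ)
    (Ct : Matrix (Fin p) (Fin n) ℝ) : Prop where
  skew : Jtᵀ = -Jt
  posDef : Rt.PosDef
  similar : ∃ T : Matrix (Fin n) (Fin n) ℝ, IsUnit T ∧
    T * A = (Jt - Rt) * T ∧ Bt = T * B ∧ C = Ct * T

/-- The Lyapunov equations for `P`, `Q` and the Sylvester equations for `X`, `Y` at the reduced
system `x = (J_r, R_r, B_r, C_r)`; `At`, `Bt`, `Ct` are the matrices of the full system. -/
structure SolvesGramEqs {n r m p : ℕ} (At : Matrix (Fin n) (Fin n) ℝ)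
    (Bt : Matrix (Fin n) (Fin m) ℝ) (Ct : Matrix (Fin p) (Fin n) ℝ) (x : PHSpace r m p)
    (P Q : Matrix (Fin r) (Fin r) ℝ) (X Y : Matrix (Fin n) (Fin r) ℝ) : Prop where
  eqP : (x.J - x.R) * P + P * (x.J - x.R)ᵀ + x.B * x.Bᵀ = 0
  eqQ : (x.J - x.R)ᵀ * Q + Q * (x.J - x.R) + x.Cᵀ * x.C = 0
  eqX : At * X + X * (x.J - x.R)ᵀ + Bt * x.Bᵀ = 0
  eqY : Atᵀ * Y + Y * (x.J - x.R) - Ctᵀ * x.C = 0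

/-- The equations obtained by differentiating those of `SolvesGramEqs` at `x` in the direction
`v = (J', R', B', C')`. -/
structure SolvesDerivGramEqs {n r m p : ℕ} (At : Matrix (Fin n) (Fin n) ℝ)
    (Bt : Matrix (Fin n) (Fin m) ℝ) (Ct : Matrix (Fin p) (Fin n) ℝ) (x v : PHSpace r m p)
    (P Q : Matrix (Fin r) (Fin r) ℝ) (X Y : Matrix (Fin n) (Fin r) ℝ)
    (P' Q' : Matrix (Fin r) (Fin r) ℝ) (X' Y' : Matrix (Fin n) (Fin r) ℝ) : Prop where
  eqP' : (x.J - x.R) * P' + P' * (x.J - x.R)ᵀ + (v.J - v.R) * P + P * (v.J - v.R)ᵀ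
    + v.B * x.Bᵀ + x.B * v.Bᵀ = 0
  eqQ' : (x.J - x.R)ᵀ * Q' + Q' * (x.J - x.R) + (v.J - v.R)ᵀ * Q + Q * (v.J - v.R)
    + v.Cᵀ * x.C + x.Cᵀ * v.C = 0
  eqX' : At * X' + X' * (x.J - x.R)ᵀ + X * (v.J - v.R)ᵀ + Bt * v.Bᵀ = 0
  eqY' : Atᵀ * Y' + Y' * (x.J - x.R) + Y * (v.J - v.R) - Ctᵀ * v.C = 0

end

/-! ### Integrals along the imaginary axis -/

/-! A change of state coordinates does not alter `G`, so the full system may be taken to be `(Jt -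
Rt, Bt, Ct)`. A skew matrix minus a positive definite one has a negative definite quadratic form
(`IsDissipative`), and this property does two jobs. It keeps the spectrum out of the closed right
half-plane (`isUnit_smul_one_sub`), and it makes `X ↦ A X + X B` injective, hence invertible, when
`A` and `B` are dissipative (`eq_zero_of_sylvester`). Thus all Lyapunov and Sylvester equations are
uniquely solvable, and their solutions depend smoothly on the data because operator inversion is
smooth.

The error `G - G_r` is the transfer function of a block diagonal system. With `S = it - A`, the
Lyapunov equation `A Z + Z Aᵀ + B Bᵀ = 0` gives `S⁻¹ B Bᵀ S⁻* = S⁻¹ Z + Z S⁻*`, so the integrand of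
the squared `H²` norm is linear in the resolvent. Cauchy's theorem in the right half-plane then
evaluates the integral as `2π tr(C Z Cᵀ)`. For the error system the blocks of `Z` are `W, X, Xᵀ, P`,
whence `f = tr(Ct W Ctᵀ) - 2 tr(Ct X C_rᵀ) + tr(C_r P C_rᵀ)`, where `W` does not depend on the
reduced system.

Differentiating `f` produces `P'` and `X'`. Pairing their equations with the adjoint equations for
`Q` and `Y` (`trace_transpose_mul_sylvester`) eliminates them, and `fderiv_objective` is an explicit
linear form in the direction, from which the metric reads off the gradient. The Hessian is the
derivative of this gradient field plus the Christoffel term. The latter lives only in the positive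
definite factor, where it cancels half of what the product rule yields from the outer factors of `R
sym(QP + YᵀX) R`. -/

open Filter Topology Bornology Asymptotics in
-- Cauchy's theorem on the rectangle `[0, S] × [-S, S]`: quadratic decay beats the linear growth of
-- the three sides off the imaginary axis, so only the axis survives as `S → ∞`.
theorem integrable_and_integral_imaginaryAxis_eq_zero {E : Type*} [NormedAddCommGroup E]
    [NormedSpace ℂ E] {F : ℂ → E} (hF : ∀ s : ℂ, 0 ≤ s.re → DifferentiableAt ℂ F s)
    (hO : F =O[cobounded ℂ] fun s => (‖s‖ ^ 2)⁻¹) :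
    Integrable (fun t : ℝ => F (Complex.I * t)) ∧ ∫ t : ℝ, F (Complex.I * t) = 0 := by
  have hcont : Continuous fun t : ℝ => F (Complex.I * t) := by
    rw [continuous_iff_continuousAt]
    intro t
    exact (hF _ (by simp)).continuousAt.comp (f := fun t : ℝ => Complex.I * (t : ℂ))
      (by fun_prop)
  obtain ⟨K, hK⟩ := hO.bound
  obtain ⟨ρ, -, hρ⟩ := (hasBasis_cobounded_norm (E := ℂ)).eventually_iff.1 hK
  have hbd : ∀ s : ℂ, ρ ≤ ‖s‖ → ‖F s‖ ≤ K * (‖s‖ ^ 2)⁻¹ := fun s hs => by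
    simpa using hρ hs
  -- The factor 2 comes from `1 / t² ≤ 2 / (1 + t²)` for `|t| ≥ 1`.
  have hev : ∀ t : ℝ, max ρ 1 ≤ |t| → ‖F (Complex.I * t)‖ ≤ 2 * |K| * ‖(1 + t ^ 2)⁻¹‖ := by
    intro t ht
    have h1 : 1 ≤ |t| := (le_max_right _ _).trans ht
    have h2 : 1 ≤ t ^ 2 := by rw [← sq_abs]; nlinarith
    have h3 := hbd (Complex.I * t) (by simpa using (le_max_left _ _).trans ht)
    have h4 : (‖Complex.I * (t : ℂ)‖ ^ 2)⁻¹ = (t ^ 2)⁻¹ := by simp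
    rw [h4] at h3
    rw [Real.norm_of_nonneg (by positivity)]
    have h5 : (t ^ 2)⁻¹ ≤ 2 * (1 + t ^ 2)⁻¹ := by
      rw [← div_eq_mul_inv, inv_eq_one_div, div_le_div_iff₀ (by positivity) (by positivity)]
      linarith
    calc ‖F (Complex.I * t)‖ ≤ K * (t ^ 2)⁻¹ := h3
      _ ≤ |K| * (t ^ 2)⁻¹ := by gcongr; exact le_abs_self K
      _ ≤ |K| * (2 * (1 + t ^ 2)⁻¹) := by gcongr
      _ = 2 * |K| * (1 + t ^ 2)⁻¹ := by ring
  have hint : Integrable fun t : ℝ => F (Complex.I * t) := by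
    refine hcont.locallyIntegrable.integrable_of_isBigO_atBot_atTop
      (g := fun t : ℝ => (1 + t ^ 2)⁻¹) (g' := fun t : ℝ => (1 + t ^ 2)⁻¹) ?_
      (integrable_inv_one_add_sq.integrableAtFilter _) ?_
      (integrable_inv_one_add_sq.integrableAtFilter _)
    · refine IsBigO.of_bound (2 * |K|) ?_
      filter_upwards [eventually_le_atBot (-(max ρ 1))] with t ht
      exact hev t (le_abs.2 (Or.inr (by linarith)))
    · refine IsBigO.of_bound (2 * |K|) ?_
      filter_upwards [eventually_ge_atTop (max ρ 1)] with t ht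
      exact hev t (le_abs.2 (Or.inl ht))
  refine ⟨hint, ?_⟩
  have hlim := intervalIntegral_tendsto_integral hint tendsto_neg_atTop_atBot tendsto_id
  -- The three other sides have total length `S + S + 2S`, and on them the norm of `F` is at most
  -- `|K| / S²`; hence the bound `4 |K| / S`.
  refine tendsto_nhds_unique hlim (squeeze_zero_norm' (a := fun S : ℝ => 4 * |K| * S⁻¹) ?_ ?_)
  · filter_upwards [eventually_ge_atTop (max ρ 1)] with S hS
    have hSρ : ρ ≤ S := (le_max_left _ _).trans hS
    have hS1 : 1 ≤ S := (le_max_right _ _).trans hS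
    have hS0 : 0 < S := by linarith
    have hrect := Complex.integral_boundary_rect_eq_zero_of_differentiableOn F
      ((-S : ℝ) * Complex.I) (S + S * Complex.I) (by
        intro s hs
        refine (hF s ?_).differentiableWithinAt
        have := (Complex.mem_reProdIm.1 hs).1
        simp [Set.uIcc_of_le hS0.le] at this
        exact this.1)
    have hB : ∀ s : ℂ, S ≤ ‖s‖ → ‖F s‖ ≤ |K| * (S ^ 2)⁻¹ := fun s hs =>
      calc ‖F s‖ ≤ K * (‖s‖ ^ 2)⁻¹ := hbd s (hSρ.trans hs)
        _ ≤ |K| * (‖s‖ ^ 2)⁻¹ := by gcongr; exact le_abs_self K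
        _ ≤ |K| * (S ^ 2)⁻¹ := by gcongr
    have e1 : ‖∫ x : ℝ in (0 : ℝ)..S, F (x + (-S : ℝ) * Complex.I)‖
        ≤ |K| * (S ^ 2)⁻¹ * |S - 0| := by
      refine intervalIntegral.norm_integral_le_of_norm_le_const fun x _ => hB _ ?_
      refine le_trans ?_ (Complex.abs_im_le_norm _)
      simpa using le_abs_self S
    have e2 : ‖∫ x : ℝ in (0 : ℝ)..S, F (x + S * Complex.I)‖ ≤ |K| * (S ^ 2)⁻¹ * |S - 0| := by
      refine intervalIntegral.norm_integral_le_of_norm_le_const fun x _ => hB _ ?_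
      refine le_trans ?_ (Complex.abs_im_le_norm _)
      simpa using le_abs_self S
    have e3 : ‖∫ y : ℝ in (-S)..S, F (S + y * Complex.I)‖ ≤ |K| * (S ^ 2)⁻¹ * |S - (-S)| := by
      refine intervalIntegral.norm_integral_le_of_norm_le_const fun x _ => hB _ ?_
      refine le_trans ?_ (Complex.abs_re_le_norm _)
      simpa using le_abs_self S
    simp only [Complex.mul_re, Complex.mul_im, Complex.ofReal_re, Complex.ofReal_im, Complex.I_re,
      Complex.I_im, Complex.add_re, Complex.add_im, mul_zero, mul_one, sub_zero,
      add_zero, zero_add] at hrect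
    have hcomm : (∫ y : ℝ in (-S)..S, F (Complex.I * y))
        = ∫ y : ℝ in (-S)..S, F (((0 : ℝ) : ℂ) + y * Complex.I) := by
      simp [mul_comm]
    have hval := eq_of_sub_eq_zero hrect
    have hn : ‖∫ y : ℝ in (-S)..S, F (((0 : ℝ) : ℂ) + y * Complex.I)‖
        = ‖Complex.I • ∫ y : ℝ in (-S)..S, F (((0 : ℝ) : ℂ) + y * Complex.I)‖ := by
      rw [norm_smul, Complex.norm_I, one_mul]
    simp only [id]
    rw [hcomm, hn, ← hval]
    refine (norm_add_le _ _).trans ?_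
    rw [norm_smul, Complex.norm_I, one_mul]
    have e4 := norm_sub_le (∫ x : ℝ in (0 : ℝ)..S, F (x + (-S : ℝ) * Complex.I))
      (∫ x : ℝ in (0 : ℝ)..S, F (x + S * Complex.I))
    have h1 : |S - 0| = S := by rw [sub_zero, abs_of_pos hS0]
    have h2 : |S - (-S)| = 2 * S := by rw [abs_of_pos] <;> linarith
    rw [h1] at e1 e2
    rw [h2] at e3
    have h3 : |K| * (S ^ 2)⁻¹ * S = |K| * S⁻¹ := by field_simp
    linarith
  · simpa using tendsto_inv_atTop_zero.const_mul (4 * |K|)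

open Filter Bornology Asymptotics in
-- One resolvent decays only like `1 / s`, too slowly to integrate. By the resolvent identity a
-- difference of two is a product of two resolvents around `a - b`, so it decays like `1 / s²`.
theorem integrable_and_integral_resolvent_sub_resolvent {𝔸 : Type*} [NormedRing 𝔸]
    [NormedAlgebra ℂ 𝔸] [CompleteSpace 𝔸] {a b : 𝔸}
    (ha : ∀ s : ℂ, 0 ≤ s.re → s ∈ resolventSet ℂ a)
    (hb : ∀ s : ℂ, 0 ≤ s.re → s ∈ resolventSet ℂ b) :
    Integrable (fun t : ℝ => resolvent a (Complex.I * t) - resolvent b (Complex.I * t)) ∧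
      ∫ t : ℝ, (resolvent a (Complex.I * t) - resolvent b (Complex.I * t)) = 0 := by
  refine integrable_and_integral_imaginaryAxis_eq_zero
    (F := fun s => resolvent a s - resolvent b s) (fun s hs =>
      (spectrum.hasDerivAt_resolvent_const_left (ha s hs)).differentiableAt.sub
        (spectrum.hasDerivAt_resolvent_const_left (hb s hs)).differentiableAt) ?_
  have hmem : ∀ c : 𝔸, ∀ᶠ s in cobounded ℂ, s ∈ resolventSet ℂ c := fun c =>
    Filter.mem_of_superset (isBounded_def.1 (spectrum.isBounded (𝕜 := ℂ) c)) fun s hs => by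
      simpa [spectrum] using hs
  have hprod : (fun s => resolvent a s * ((a - b) * resolvent b s))
      =O[cobounded ℂ] fun s : ℂ => s⁻¹ * s⁻¹ :=
    (spectrum.resolvent_isBigO_inv a).mul
      ((isBigO_refl _ _).const_mul_left (a - b) |>.trans (spectrum.resolvent_isBigO_inv b))
  refine (hprod.congr' ?_ EventuallyEq.rfl).trans
    (IsBigO.of_bound 1 (Eventually.of_forall fun s => by simp [sq]))
  filter_upwards [hmem a, hmem b] with s h1 h2
  have e1 : resolvent a s * (algebraMap ℂ 𝔸 s - a) = 1 := Ring.inverse_mul_cancel _ h1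
  have e2 : (algebraMap ℂ 𝔸 s - b) * resolvent b s = 1 := Ring.mul_inverse_cancel _ h2
  calc resolvent a s * ((a - b) * resolvent b s)
      = resolvent a s * ((algebraMap ℂ 𝔸 s - b) * resolvent b s)
        - resolvent a s * (algebraMap ℂ 𝔸 s - a) * resolvent b s := by noncomm_ring
    _ = resolvent a s - resolvent b s := by rw [e1, e2]; simp

theorem integrable_and_integral_linear_resolvent_sub_resolvent {𝔸 : Type*} [NormedRing 𝔸]
    [NormedAlgebra ℂ 𝔸] [FiniteDimensional ℂ 𝔸] {a b : 𝔸}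
    (ha : ∀ s : ℂ, 0 ≤ s.re → s ∈ resolventSet ℂ a)
    (hb : ∀ s : ℂ, 0 ≤ s.re → s ∈ resolventSet ℂ b) (φ : 𝔸 →ₗ[ℂ] ℂ) :
    Integrable (fun t : ℝ => φ (resolvent a (Complex.I * t) - resolvent b (Complex.I * t))) ∧
      ∫ t : ℝ, φ (resolvent a (Complex.I * t) - resolvent b (Complex.I * t)) = 0 := by
  have : CompleteSpace 𝔸 := FiniteDimensional.complete ℂ 𝔸
  obtain ⟨h1, h2⟩ := integrable_and_integral_resolvent_sub_resolvent ha hb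
  let L : 𝔸 →L[ℂ] ℂ := LinearMap.toContinuousLinearMap φ
  have h3 := L.integral_comp_comm h1
  rw [h2, map_zero] at h3
  exact ⟨L.integrable_comp h1, h3⟩

/-! ### The squared `H²` norm from a Lyapunov equation -/

section

variable {ι : Type*} [Fintype ι] [DecidableEq ι]

theorem resolvent_eq_inv (A : Matrix ι ι ℂ) (s : ℂ) :
    resolvent A s = (s • (1 : Matrix ι ι ℂ) - A)⁻¹ := by
  rw [resolvent, ← nonsing_inv_eq_ringInverse, Algebra.algebraMap_eq_smul_one]

/-- The comparison matrix is `-1`: its resolvent is the explicit scalar matrix `(1 + s)⁻¹`, whose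
real part on the axis is `1 / (1 + t²)`, with integral `π`. -/
theorem integrable_and_integral_linear_inv_sub {A : Matrix ι ι ℂ}
    (hA : ∀ s : ℂ, 0 ≤ s.re → IsUnit (s • (1 : Matrix ι ι ℂ) - A)) (φ : Matrix ι ι ℂ →ₗ[ℂ] ℂ) :
    Integrable (fun t : ℝ => φ (((Complex.I * t) • (1 : Matrix ι ι ℂ) - A)⁻¹
        - (1 + Complex.I * t)⁻¹ • 1)) ∧
      ∫ t : ℝ, φ (((Complex.I * t) • (1 : Matrix ι ι ℂ) - A)⁻¹
        - (1 + Complex.I * t)⁻¹ • 1) = 0 := by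
  let _ : NormedRing (Matrix ι ι ℂ) := Matrix.linftyOpNormedRing
  let _ : NormedAlgebra ℂ (Matrix ι ι ℂ) := Matrix.linftyOpNormedAlgebra
  have hne : ∀ s : ℂ, 0 ≤ s.re → (1 + s) ≠ 0 := fun s hs h => by
    have := congrArg Complex.re h
    simp at this
    linarith
  have hone : ∀ s : ℂ, s • (1 : Matrix ι ι ℂ) - (-1) = (1 + s) • 1 := fun s => by
    rw [add_smul, one_smul]
    abel
  have ha : ∀ s : ℂ, 0 ≤ s.re → s ∈ resolventSet ℂ A := fun s hs => by
    simpa [resolventSet, Algebra.algebraMap_eq_smul_one] using hA s hs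
  have hb : ∀ s : ℂ, 0 ≤ s.re → s ∈ resolventSet ℂ (-1 : Matrix ι ι ℂ) := fun s hs => by
    rw [spectrum.mem_resolventSet_iff, Algebra.algebraMap_eq_smul_one, hone]
    exact isUnit_one.smul (Units.mk0 _ (hne s hs))
  have hres : ∀ t : ℝ, resolvent A (Complex.I * t) - resolvent (-1) (Complex.I * t)
      = ((Complex.I * t) • (1 : Matrix ι ι ℂ) - A)⁻¹ - (1 + Complex.I * t)⁻¹ • 1 := fun t => by
    rw [resolvent_eq_inv, resolvent_eq_inv, hone]
    congr 1
    refine inv_eq_right_inv ?_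
    rw [smul_mul_smul_comm, mul_inv_cancel₀ (hne _ (by simp)), one_smul, one_mul]
  simpa only [hres] using integrable_and_integral_linear_resolvent_sub_resolvent ha hb φ

theorem frobNorm_sq {p m : ℕ} (G : Matrix (Fin p) (Fin m) ℂ) :
    frobNorm G ^ 2 = (G * Gᴴ).trace.re := by
  have h : (Gᴴ * G).trace.re = ∑ i, ∑ j, ‖G j i‖ ^ 2 := by
    simp only [trace, diag_apply, mul_apply, conjTranspose_apply, Complex.re_sum]
    refine Finset.sum_congr rfl fun i _ => Finset.sum_congr rfl fun j _ => ?_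
    rw [← Complex.normSq_eq_norm_sq, Complex.normSq_apply]
    simp
  rw [frobNorm, Real.sq_sqrt (by rw [h]; positivity), trace_mul_comm]

theorem map_ofReal_mul {l k q : Type*} [Fintype k] (M : Matrix l k ℝ) (N : Matrix k q ℝ) :
    (M * N).map Complex.ofReal = M.map Complex.ofReal * N.map Complex.ofReal :=
  Matrix.map_mul (f := Complex.ofRealHom)

theorem conjTranspose_map_ofReal {l k : Type*} (M : Matrix l k ℝ) :
    (M.map Complex.ofReal)ᴴ = Mᵀ.map Complex.ofReal := by
  ext i j
  simp

/-- The squared `H²` norm of `C (s I - A)⁻¹ B` in terms of a solution of the Lyapunov equation. -/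
theorem integrable_and_integral_frobNorm_sq {m p : ℕ} {A Z : Matrix ι ι ℝ}
    {B : Matrix ι (Fin m) ℝ} (C : Matrix (Fin p) ι ℝ)
    (hA : ∀ s : ℂ, 0 ≤ s.re → IsUnit (s • (1 : Matrix ι ι ℂ) - A.map Complex.ofReal))
    (hZ : A * Z + Z * Aᵀ + B * Bᵀ = 0) :
    Integrable (fun t : ℝ => frobNorm (C.map Complex.ofReal
        * ((Complex.I * t) • (1 : Matrix ι ι ℂ) - A.map Complex.ofReal)⁻¹
        * B.map Complex.ofReal) ^ 2) ∧
      ∫ t : ℝ, frobNorm (C.map Complex.ofReal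
        * ((Complex.I * t) • (1 : Matrix ι ι ℂ) - A.map Complex.ofReal)⁻¹
        * B.map Complex.ofReal) ^ 2 = 2 * Real.pi * (C * Z * Cᵀ).trace := by
  set Ac := A.map Complex.ofReal with hAc
  set Cc := C.map Complex.ofReal with hCc
  set Bc := B.map Complex.ofReal with hBc
  set Zc := Z.map Complex.ofReal with hZc
  -- `Z` is not assumed symmetric. The two halves of `S⁻¹ Z + Z S⁻*` contribute `Z` and `Zᵀ` once
  -- conjugation has moved the resolvent to the left.
  let φ : Matrix ι ι ℂ →ₗ[ℂ] ℂ :=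
    { toFun := fun M => (Cc * M * (Zc + Zcᵀ) * Ccᴴ).trace
      map_add' := fun M N => by simp only [Matrix.mul_add, Matrix.add_mul, trace_add]; ring
      map_smul' := fun c M => by simp }
  have hφ : ∀ M, φ M = (Cc * M * (Zc + Zcᵀ) * Ccᴴ).trace := fun M => rfl
  obtain ⟨h1, h2⟩ := integrable_and_integral_linear_inv_sub hA φ
  have hZ' : Ac * Zc + Zc * Acᴴ + Bc * Bcᴴ = 0 := by
    rw [hAc, hBc, conjTranspose_map_ofReal, conjTranspose_map_ofReal, hZc, ← map_ofReal_mul,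
      ← map_ofReal_mul, ← map_ofReal_mul, ← Matrix.map_add _ Complex.ofReal_add,
      ← Matrix.map_add _ Complex.ofReal_add, hZ]
    ext
    simp
  have hφ1 : φ 1 = ((2 * (C * Z * Cᵀ).trace : ℝ) : ℂ) := by
    have e : (C * Zᵀ * Cᵀ).trace = (C * Z * Cᵀ).trace := by
      rw [← trace_transpose]
      simp [Matrix.mul_assoc]
    have e' : (C * (Z + Zᵀ) * Cᵀ).trace = 2 * (C * Z * Cᵀ).trace := by
      rw [Matrix.mul_add, Matrix.add_mul, trace_add, e]
      ring
    have e2 : Zc + Zcᵀ = (Z + Zᵀ).map Complex.ofReal := by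
      ext
      simp [hZc]
    rw [hφ, Matrix.mul_one, hCc, conjTranspose_map_ofReal, e2, ← map_ofReal_mul, ← map_ofReal_mul,
      ← e']
    exact (AddMonoidHom.map_trace Complex.ofRealHom.toAddMonoidHom _).symm
  have hpt : ∀ t : ℝ, frobNorm (Cc * ((Complex.I * t) • (1 : Matrix ι ι ℂ) - Ac)⁻¹ * Bc) ^ 2
      = (φ (((Complex.I * t) • (1 : Matrix ι ι ℂ) - Ac)⁻¹ - (1 + Complex.I * t)⁻¹ • 1)).re
        + (1 + t ^ 2)⁻¹ * (2 * (C * Z * Cᵀ).trace) := by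
    intro t
    set S := (Complex.I * t) • (1 : Matrix ι ι ℂ) - Ac with hS
    have hSu : IsUnit S.det := (isUnit_iff_isUnit_det S).1 (hA _ (by simp))
    have hSH : Sᴴ = (-(Complex.I * t)) • (1 : Matrix ι ι ℂ) - Acᴴ := by
      rw [hS, conjTranspose_sub, conjTranspose_smul, conjTranspose_one]
      simp
    have hSHu : IsUnit (Sᴴ).det := by
      rw [det_conjTranspose]
      exact hSu.star
    have hkey : S * Zc + Zc * Sᴴ = Bc * Bcᴴ := by
      rw [hSH, hS, Matrix.sub_mul, Matrix.mul_sub, Matrix.smul_mul, Matrix.mul_smul,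
        Matrix.one_mul, Matrix.mul_one, neg_smul, ← sub_eq_zero]
      rw [← neg_eq_zero, ← hZ']
      abel
    -- The Lyapunov equation turns an expression quadratic in the resolvent into a linear one.
    have hmid : S⁻¹ * (Bc * Bcᴴ) * (S⁻¹)ᴴ = S⁻¹ * Zc + Zc * (S⁻¹)ᴴ := by
      rw [← hkey, conjTranspose_nonsing_inv, Matrix.mul_add, Matrix.add_mul, ← Matrix.mul_assoc,
        nonsing_inv_mul _ hSu, Matrix.one_mul, Matrix.mul_assoc, Matrix.mul_assoc,
        mul_nonsing_inv _ hSHu, Matrix.mul_one, add_comm]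
    have hφS : (φ S⁻¹).re = ((1 + Complex.I * t)⁻¹ * φ 1).re
        + (φ (S⁻¹ - (1 + Complex.I * t)⁻¹ • 1)).re := by
      rw [map_sub, map_smul, smul_eq_mul, Complex.sub_re]
      ring
    have hreal : ((1 + Complex.I * t)⁻¹ * φ 1).re
        = (1 + t ^ 2)⁻¹ * (2 * (C * Z * Cᵀ).trace) := by
      rw [hφ1, Complex.re_mul_ofReal]
      congr 1
      rw [Complex.inv_re]
      simp [Complex.normSq_apply, sq]
    have hconj : (Cc * (Zc * (S⁻¹)ᴴ) * Ccᴴ).trace.re = (Cc * S⁻¹ * Zcᵀ * Ccᴴ).trace.re := by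
      have hZH : Zcᴴ = Zcᵀ := conjTranspose_map_ofReal Z
      rw [← Complex.conj_re, starRingEnd_apply, ← trace_conjTranspose]
      simp only [conjTranspose_mul, conjTranspose_conjTranspose, hZH, Matrix.mul_assoc]
    rw [frobNorm_sq]
    have hG : Cc * S⁻¹ * Bc * (Cc * S⁻¹ * Bc)ᴴ = Cc * (S⁻¹ * (Bc * Bcᴴ) * (S⁻¹)ᴴ) * Ccᴴ := by
      simp only [conjTranspose_mul, Matrix.mul_assoc]
    rw [hG, hmid, Matrix.mul_add, Matrix.add_mul, trace_add, Complex.add_re, hconj, ← hreal,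
      add_comm (φ _).re, ← hφS, hφ, Matrix.mul_add, Matrix.add_mul, trace_add, Complex.add_re,
      Matrix.mul_assoc Cc S⁻¹ Zc]
  simp only [hpt]
  have h3 := integrable_inv_one_add_sq.mul_const (2 * (C * Z * Cᵀ).trace)
  refine ⟨h1.re.add h3, ?_⟩
  have h4 : ∫ t : ℝ, (φ (((Complex.I * t) • (1 : Matrix ι ι ℂ) - Ac)⁻¹
      - (1 + Complex.I * t)⁻¹ • 1)).re = 0 := by
    have := integral_re h1
    rw [h2] at this
    exact this
  refine (integral_add h1.re h3).trans ((congrArg₂ (· + ·) h4 rfl).trans ?_)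
  rw [integral_mul_const, integral_univ_inv_one_add_sq]
  ring

end

/-! ### Dissipative matrices and the Sylvester equation -/

/-- The quadratic form of `A` is negative definite. -/
def IsDissipative {ι : Type*} [Fintype ι] (A : Matrix ι ι ℝ) : Prop :=
  ∀ v : ι → ℝ, v ≠ 0 → v ⬝ᵥ (A *ᵥ v) < 0

namespace IsDissipative

variable {ι κ : Type*} [Fintype ι] [Fintype κ]

theorem nonpos {A : Matrix ι ι ℝ} (hA : IsDissipative A) (v : ι → ℝ) : v ⬝ᵥ (A *ᵥ v) ≤ 0 := by
  by_cases hv : v = 0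
  · simp [hv]
  · exact (hA v hv).le

theorem transpose {A : Matrix ι ι ℝ} (hA : IsDissipative A) : IsDissipative Aᵀ := fun v hv => by
  rw [mulVec_transpose, dotProduct_comm, ← dotProduct_mulVec]
  exact hA v hv

/-- The quadratic form of a skew matrix vanishes, so only that of `-R` is left. -/
theorem sub_of_skew {J R : Matrix ι ι ℝ} (hJ : Jᵀ = -J) (hR : R.PosDef) :
    IsDissipative (J - R) := fun v hv => by
  have h1 : v ⬝ᵥ (J *ᵥ v) = 0 := by
    have h : v ⬝ᵥ (Jᵀ *ᵥ v) = v ⬝ᵥ (J *ᵥ v) := by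
      rw [mulVec_transpose, dotProduct_comm, ← dotProduct_mulVec]
    rw [hJ, neg_mulVec, dotProduct_neg] at h
    linarith
  have h2 : 0 < v ⬝ᵥ (R *ᵥ v) := by simpa using hR.dotProduct_mulVec_pos hv
  rw [sub_mulVec, dotProduct_sub, h1]
  linarith

/-- Pairing the equation with `X` gives the form of `A` summed over the columns of `X` plus the form
of `Bᵀ` summed over its rows. All terms are nonpositive and the total is zero, so each column has
zero `A`-form and vanishes. -/
theorem eq_zero_of_sylvester {A : Matrix ι ι ℝ} {B : Matrix κ κ ℝ} (hA : IsDissipative A)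
    (hB : IsDissipative B) {X : Matrix ι κ ℝ} (hX : A * X + X * B = 0) : X = 0 := by
  have e1 : (Xᵀ * (A * X)).trace = ∑ j, (X.col j) ⬝ᵥ (A *ᵥ X.col j) := by
    refine Finset.sum_congr rfl fun j _ => ?_
    simp [mul_apply, dotProduct, mulVec, col]
  have e2 : (Xᵀ * (X * B)).trace = ∑ i, (X.row i) ⬝ᵥ (Bᵀ *ᵥ X.row i) := by
    rw [trace_mul_comm]
    refine Finset.sum_congr rfl fun i _ => ?_
    simp [mul_apply, dotProduct, mulVec, row, mul_comm]
  have h := congrArg (fun M => (Xᵀ * M).trace) hX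
  simp only [Matrix.mul_add, trace_add, Matrix.mul_zero, trace_zero] at h
  have h2 : ∑ i, (X.row i) ⬝ᵥ (Bᵀ *ᵥ X.row i) ≤ 0 :=
    Finset.sum_nonpos fun i _ => hB.transpose.nonpos _
  have h1 : ∑ j, (X.col j) ⬝ᵥ (A *ᵥ X.col j) = 0 :=
    le_antisymm (Finset.sum_nonpos fun j _ => hA.nonpos _) (by linarith)
  rw [Finset.sum_eq_zero_iff_of_nonpos fun j _ => hA.nonpos _] at h1
  ext i j
  by_contra hne
  exact (hA (X.col j) fun h0 => hne (congrFun h0 i)).ne (h1 j (Finset.mem_univ _))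

/-- For a kernel vector `v = a + ib`, the real part of `v* A v = s |v|²` says that the forms of `A`
at `a` and `b` add up to `re s · |v|² ≥ 0`, which forces `a = b = 0`. -/
theorem isUnit_smul_one_sub [DecidableEq ι] {A : Matrix ι ι ℝ} (hA : IsDissipative A) {s : ℂ}
    (hs : 0 ≤ s.re) : IsUnit (s • (1 : Matrix ι ι ℂ) - A.map Complex.ofReal) := by
  rw [← mulVec_injective_iff_isUnit, ← coe_mulVecLin, ← LinearMap.ker_eq_bot, LinearMap.ker_eq_bot']
  intro v hv
  rw [mulVecLin_apply, sub_mulVec, smul_mulVec, one_mulVec, sub_eq_zero] at hv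
  set a : ι → ℝ := fun i => (v i).re with ha
  set b : ι → ℝ := fun i => (v i).im with hb
  have hre : A *ᵥ a = s.re • a - s.im • b := by
    ext i
    have := congrArg Complex.re (congrFun hv i)
    simp [mulVec, dotProduct, ha, hb] at this ⊢
    exact this.symm
  have him : A *ᵥ b = s.re • b + s.im • a := by
    ext i
    have := congrArg Complex.im (congrFun hv i)
    simp [mulVec, dotProduct, ha, hb] at this ⊢
    exact this.symm
  have h1 : a ⬝ᵥ (A *ᵥ a) + b ⬝ᵥ (A *ᵥ b) = s.re * (a ⬝ᵥ a + b ⬝ᵥ b) := by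
    rw [hre, him]
    simp only [dotProduct_sub, dotProduct_add, dotProduct_smul, smul_eq_mul, dotProduct_comm b a]
    ring
  have hnn : ∀ w : ι → ℝ, 0 ≤ w ⬝ᵥ w := fun w => Finset.sum_nonneg fun i _ => mul_self_nonneg _
  have h2 : 0 ≤ a ⬝ᵥ (A *ᵥ a) + b ⬝ᵥ (A *ᵥ b) := by
    rw [h1]
    exact mul_nonneg hs (add_nonneg (hnn a) (hnn b))
  have h3 := hA.nonpos a
  have h4 := hA.nonpos b
  have ha0 : a = 0 := by
    by_contra hne
    linarith [hA a hne]
  have hb0 : b = 0 := by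
    by_contra hne
    linarith [hA b hne]
  ext i
  exact Complex.ext (congrFun ha0 i) (congrFun hb0 i)

end IsDissipative

/-! ### Calculus of matrix-valued functions -/

noncomputable section

variable {ι κ μ : Type*} [Fintype κ] [Fintype μ]

section Calculus

theorem HasDerivAt.matrix_apply {M : ℝ → Matrix ι κ ℝ} {M' : Matrix ι κ ℝ} {t : ℝ}
    (hM : HasDerivAt M M' t) (i : ι) (j : κ) : HasDerivAt (fun u => M u i j) (M' i j) t :=
  hasDerivAt_pi.1 (hasDerivAt_pi.1 hM i) j

theorem HasDerivAt.of_matrix_apply {M : ℝ → Matrix ι κ ℝ} {M' : Matrix ι κ ℝ} {t : ℝ}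
    (hM : ∀ i j, HasDerivAt (fun u => M u i j) (M' i j) t) : HasDerivAt M M' t :=
  hasDerivAt_pi.2 fun i => hasDerivAt_pi.2 fun j => hM i j

theorem HasDerivAt.matMul {M : ℝ → Matrix ι κ ℝ} {N : ℝ → Matrix κ μ ℝ} {M' : Matrix ι κ ℝ}
    {N' : Matrix κ μ ℝ} {t : ℝ} (hM : HasDerivAt M M' t) (hN : HasDerivAt N N' t) :
    HasDerivAt (fun u => M u * N u) (M' * N t + M t * N') t :=
  .of_matrix_apply fun i j => by
    simp only [mul_apply, Matrix.add_apply, ← Finset.sum_add_distrib]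
    exact HasDerivAt.fun_sum fun k _ => (hM.matrix_apply i k).fun_mul (hN.matrix_apply k j)

variable [Fintype ι]

theorem HasDerivAt.matTranspose {M : ℝ → Matrix ι κ ℝ} {M' : Matrix ι κ ℝ} {t : ℝ}
    (hM : HasDerivAt M M' t) : HasDerivAt (fun u => (M u)ᵀ) M'ᵀ t :=
  .of_matrix_apply fun i j => hM.matrix_apply j i

theorem HasDerivAt.matTrace {M : ℝ → Matrix ι ι ℝ} {M' : Matrix ι ι ℝ} {t : ℝ}
    (hM : HasDerivAt M M' t) : HasDerivAt (fun u => (M u).trace) M'.trace t :=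
  HasDerivAt.fun_sum fun i _ => hM.matrix_apply i i

variable {E : Type*} [NormedAddCommGroup E] [NormedSpace ℝ E] {x : E}

theorem ContDiffAt.matrix_apply {M : E → Matrix ι κ ℝ} (hM : ContDiffAt ℝ ∞ M x) (i : ι) (j : κ) :
    ContDiffAt ℝ ∞ (fun y => M y i j) x :=
  contDiffAt_pi.1 (contDiffAt_pi.1 hM i) j

theorem ContDiffAt.of_matrix_apply {M : E → Matrix ι κ ℝ}
    (hM : ∀ i j, ContDiffAt ℝ ∞ (fun y => M y i j) x) : ContDiffAt ℝ ∞ M x :=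
  contDiffAt_pi.2 fun i => contDiffAt_pi.2 fun j => hM i j

theorem ContDiffAt.matMul {M : E → Matrix ι κ ℝ} {N : E → Matrix κ μ ℝ}
    (hM : ContDiffAt ℝ ∞ M x) (hN : ContDiffAt ℝ ∞ N x) :
    ContDiffAt ℝ ∞ (fun y => M y * N y) x :=
  .of_matrix_apply fun i j =>
    ContDiffAt.sum fun k _ => (hM.matrix_apply i k).mul (hN.matrix_apply k j)

theorem ContDiffAt.matTranspose {M : E → Matrix ι κ ℝ} (hM : ContDiffAt ℝ ∞ M x) :
    ContDiffAt ℝ ∞ (fun y => (M y)ᵀ) x :=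
  .of_matrix_apply fun i j => hM.matrix_apply j i

theorem ContDiffAt.matTrace {M : E → Matrix ι ι ℝ} (hM : ContDiffAt ℝ ∞ M x) :
    ContDiffAt ℝ ∞ (fun y => (M y).trace) x :=
  ContDiffAt.sum fun i _ => hM.matrix_apply i i

end Calculus

/-! ### Smooth solution of Sylvester equations -/

variable [Fintype ι]

/-- A bilinear map between finite-dimensional spaces as a continuous bilinear map. -/
def bilinCLM {E F G : Type*} [NormedAddCommGroup E] [NormedSpace ℝ E] [FiniteDimensional ℝ E]
    [NormedAddCommGroup F] [NormedSpace ℝ F] [FiniteDimensional ℝ F] [NormedAddCommGroup G]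
    [NormedSpace ℝ G] (f : E →ₗ[ℝ] F →ₗ[ℝ] G) : E →L[ℝ] F →L[ℝ] G :=
  LinearMap.toContinuousBilinearMap f

/-- The Sylvester operator `X ↦ A X + X B`, as a function of `(A, B)`. -/
def sylvesterCLM := bilinCLM (E := Matrix ι ι ℝ × Matrix κ κ ℝ) (F := Matrix ι κ ℝ)
  (G := Matrix ι κ ℝ) (LinearMap.mk₂ ℝ (fun z X => z.1 * X + X * z.2)
    (fun z w X => by simp only [Prod.fst_add, Prod.snd_add, Matrix.add_mul, Matrix.mul_add]; abel)
    (fun c z X => by simp [smul_add])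
    (fun z X Y => by simp only [Matrix.add_mul, Matrix.mul_add]; abel)
    (fun c z X => by simp [smul_add]))

/-- The solution `X` of the Sylvester equation `A X + X B + K = 0`. -/
def sylvesterSol (A : Matrix ι ι ℝ) (B : Matrix κ κ ℝ) (K : Matrix ι κ ℝ) : Matrix ι κ ℝ :=
  (sylvesterCLM (A, B)).inverse (-K)

theorem exists_equiv_eq_of_forall_eq_zero {E : Type*} [NormedAddCommGroup E] [NormedSpace ℝ E]
    [FiniteDimensional ℝ E] (f : E →L[ℝ] E) (hf : ∀ x, f x = 0 → x = 0) :
    ∃ e : E ≃L[ℝ] E, (e : E →L[ℝ] E) = f := by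
  have hinj : Function.Injective (f : E →ₗ[ℝ] E) := by
    rw [← LinearMap.ker_eq_bot, LinearMap.ker_eq_bot']
    exact hf
  exact ⟨(LinearEquiv.ofInjectiveEndo _ hinj).toContinuousLinearEquiv, by ext; rfl⟩

theorem eq_inverse_neg_iff {E : Type*} [NormedAddCommGroup E] [NormedSpace ℝ E]
    [FiniteDimensional ℝ E] (f : E →L[ℝ] E) (hf : ∀ x, f x = 0 → x = 0) (x k : E) :
    x = f.inverse (-k) ↔ f x + k = 0 := by
  obtain ⟨e, rfl⟩ := exists_equiv_eq_of_forall_eq_zero f hf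
  rw [ContinuousLinearMap.inverse_equiv, ContinuousLinearEquiv.coe_coe,
    ContinuousLinearEquiv.eq_symm_apply, ContinuousLinearEquiv.coe_coe, eq_neg_iff_add_eq_zero]

/-- In finite dimension injectivity of `f x` makes it invertible, and inversion of operators is
smooth at invertible ones. -/
theorem ContDiffAt.inverse_neg_apply {E F : Type*} [NormedAddCommGroup E] [NormedSpace ℝ E]
    [NormedAddCommGroup F] [NormedSpace ℝ F] [FiniteDimensional ℝ F] {f : E → F →L[ℝ] F}
    {k : E → F} {x : E} (hf : ContDiffAt ℝ ∞ f x) (hk : ContDiffAt ℝ ∞ k x)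
    (hx : ∀ y, f x y = 0 → y = 0) : ContDiffAt ℝ ∞ (fun y => (f y).inverse (-(k y))) x := by
  obtain ⟨e, he⟩ := exists_equiv_eq_of_forall_eq_zero (f x) hx
  have : CompleteSpace F := FiniteDimensional.complete ℝ F
  have h2 : ContDiffAt ℝ ∞ ContinuousLinearMap.inverse (f x) := by
    rw [← he]
    exact contDiffAt_map_inverse e
  exact (h2.comp x hf).clm_apply hk.neg

/-- Dissipativity is what makes `sylvesterSol` meaningful: `ContinuousLinearMap.inverse` is `0` at a
non-invertible operator. -/
theorem eq_sylvesterSol_iff {A : Matrix ι ι ℝ} {B : Matrix κ κ ℝ} (hA : IsDissipative A)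
    (hB : IsDissipative B) {K X : Matrix ι κ ℝ} :
    X = sylvesterSol A B K ↔ A * X + X * B + K = 0 :=
  eq_inverse_neg_iff (sylvesterCLM (A, B)) (fun _ hX => hA.eq_zero_of_sylvester hB hX) X K

theorem sylvesterSol_spec {A : Matrix ι ι ℝ} {B : Matrix κ κ ℝ} (hA : IsDissipative A)
    (hB : IsDissipative B) (K : Matrix ι κ ℝ) :
    A * sylvesterSol A B K + sylvesterSol A B K * B + K = 0 :=
  (eq_sylvesterSol_iff hA hB).1 rfl

theorem ContDiffAt.sylvesterSol {E : Type*} [NormedAddCommGroup E] [NormedSpace ℝ E] {x : E}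
    {A : E → Matrix ι ι ℝ} {B : E → Matrix κ κ ℝ} {K : E → Matrix ι κ ℝ}
    (hA : ContDiffAt ℝ ∞ A x) (hB : ContDiffAt ℝ ∞ B x) (hK : ContDiffAt ℝ ∞ K x)
    (hAx : IsDissipative (A x)) (hBx : IsDissipative (B x)) :
    ContDiffAt ℝ ∞ (fun y => _root_.sylvesterSol (A y) (B y) (K y)) x :=
  ContDiffAt.inverse_neg_apply (f := fun y => sylvesterCLM (A y, B y))
    (sylvesterCLM.contDiff.contDiffAt.comp x (hA.prodMk hB)) hK
    (fun _ hX => hAx.eq_zero_of_sylvester hBx hX)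

end

/-! ### The objective function in terms of Lyapunov and Sylvester equations -/

/-- `s - A` is conjugate by `T` to `s - (Jt - Rt)`, and the factors `T` cancel against those in `Bt`
and `C`. -/
theorem transferFunction_eq_of_isDissipativeForm {n m p : ℕ} {A : Matrix (Fin n) (Fin n) ℝ}
    {B : Matrix (Fin n) (Fin m) ℝ} {C : Matrix (Fin p) (Fin n) ℝ}
    {Jt Rt : Matrix (Fin n) (Fin n) ℝ} {Bt : Matrix (Fin n) (Fin m) ℝ}
    {Ct : Matrix (Fin p) (Fin n) ℝ} (h : IsDissipativeForm A B C Jt Rt Bt Ct) :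
    transferFunction A B C = transferFunction (Jt - Rt) Bt Ct := by
  obtain ⟨T, hT, h1, h2, h3⟩ := h.similar
  funext s
  have hTc : IsUnit (T.map Complex.ofReal).det := by
    have : (T.map Complex.ofReal).det = Complex.ofReal T.det :=
      (RingHom.map_det Complex.ofRealHom T).symm
    rw [this, isUnit_iff_ne_zero, Complex.ofReal_ne_zero]
    exact ((isUnit_iff_isUnit_det T).1 hT).ne_zero
  set Tc := T.map Complex.ofReal
  set S := s • (1 : Matrix (Fin n) (Fin n) ℂ) - (Jt - Rt).map Complex.ofReal with hS
  have hconj : s • (1 : Matrix (Fin n) (Fin n) ℂ) - A.map Complex.ofReal = Tc⁻¹ * (S * Tc) := by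
    have : Tc * (s • (1 : Matrix (Fin n) (Fin n) ℂ) - A.map Complex.ofReal) = S * Tc := by
      rw [Matrix.mul_sub, hS, Matrix.sub_mul, ← map_ofReal_mul, ← map_ofReal_mul, h1]
      simp
    rw [← this, ← Matrix.mul_assoc, nonsing_inv_mul _ hTc, Matrix.one_mul]
  rw [transferFunction, transferFunction, ← hS, hconj, h2, h3, map_ofReal_mul, map_ofReal_mul,
    Matrix.mul_inv_rev, Matrix.mul_inv_rev, nonsing_inv_nonsing_inv _ hTc]
  simp only [Matrix.mul_assoc]
  rw [mul_nonsing_inv_cancel_left _ _ hTc]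

/-- Running both systems in parallel and subtracting the outputs realizes the error as a single
linear system, to which the `H²` formula applies. -/
theorem errorTransfer_eq_block {n r m p : ℕ} {A : Matrix (Fin n) (Fin n) ℝ}
    (B : Matrix (Fin n) (Fin m) ℝ) (C : Matrix (Fin p) (Fin n) ℝ) (x : PHSpace r m p) {s : ℂ}
    (hA : IsUnit (s • (1 : Matrix (Fin n) (Fin n) ℂ) - A.map Complex.ofReal))
    (hx : IsUnit (s • (1 : Matrix (Fin r) (Fin r) ℂ) - (x.J - x.R).map Complex.ofReal)) :
    IsUnit (s • (1 : Matrix (Fin n ⊕ Fin r) (Fin n ⊕ Fin r) ℂ)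
        - (fromBlocks A 0 0 (x.J - x.R)).map Complex.ofReal) ∧
      errorTransfer A B C x s = (fromCols C (-x.C)).map Complex.ofReal
        * (s • (1 : Matrix (Fin n ⊕ Fin r) (Fin n ⊕ Fin r) ℂ)
          - (fromBlocks A 0 0 (x.J - x.R)).map Complex.ofReal)⁻¹
        * (fromRows B x.B).map Complex.ofReal := by
  set S₁ := s • (1 : Matrix (Fin n) (Fin n) ℂ) - A.map Complex.ofReal with hS₁
  set S₂ := s • (1 : Matrix (Fin r) (Fin r) ℂ) - (x.J - x.R).map Complex.ofReal with hS₂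
  have hblock : s • (1 : Matrix (Fin n ⊕ Fin r) (Fin n ⊕ Fin r) ℂ)
      - (fromBlocks A 0 0 (x.J - x.R)).map Complex.ofReal = fromBlocks S₁ 0 0 S₂ := by
    ext i j
    rcases i with i | i <;> rcases j with j | j <;> simp [hS₁, hS₂, one_apply]
  have hinv : fromBlocks S₁ 0 0 S₂ * fromBlocks S₁⁻¹ 0 0 S₂⁻¹ = 1 := by
    rw [fromBlocks_multiply, mul_nonsing_inv _ ((isUnit_iff_isUnit_det _).1 hA),
      mul_nonsing_inv _ ((isUnit_iff_isUnit_det _).1 hx)]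
    simp
  refine ⟨hblock ▸ IsUnit.of_mul_eq_one _ hinv, ?_⟩
  have hC : (fromCols C (-x.C)).map Complex.ofReal
      = fromCols (C.map Complex.ofReal) (-x.C.map Complex.ofReal) := by
    ext i j
    rcases j with j | j <;> simp
  have hB : (fromRows B x.B).map Complex.ofReal
      = fromRows (B.map Complex.ofReal) (x.B.map Complex.ofReal) := by
    ext i j
    rcases i with i | i <;> simp
  rw [hblock, inv_eq_right_inv hinv, hC, hB, fromCols_mul_fromBlocks, fromCols_mul_fromRows]
  simp only [Matrix.mul_zero, add_zero, zero_add, Matrix.neg_mul]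
  rw [← sub_eq_add_neg]
  rfl

/-- The block Lyapunov equation splits into the equations for `W`, `X`, `P` and the transpose of the
one for `X`; the two mixed blocks have equal traces, whence the factor 2. -/
theorem integrable_and_objective_eq {n r m p : ℕ} {A : Matrix (Fin n) (Fin n) ℝ}
    (hA : IsDissipative A) {B : Matrix (Fin n) (Fin m) ℝ} (C : Matrix (Fin p) (Fin n) ℝ)
    {x : PHSpace r m p} (hx : IsDissipative (x.J - x.R)) {W : Matrix (Fin n) (Fin n) ℝ}
    {X : Matrix (Fin n) (Fin r) ℝ} {P : Matrix (Fin r) (Fin r) ℝ}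
    (hW : A * W + W * Aᵀ + B * Bᵀ = 0) (hX : A * X + X * (x.J - x.R)ᵀ + B * x.Bᵀ = 0)
    (hP : (x.J - x.R) * P + P * (x.J - x.R)ᵀ + x.B * x.Bᵀ = 0) :
    Integrable (fun t : ℝ => frobNorm (errorTransfer A B C x (Complex.I * t)) ^ 2) ∧
      objective A B C x = (C * W * Cᵀ).trace - 2 * (C * X * x.Cᵀ).trace
        + (x.C * P * x.Cᵀ).trace := by
  have hX' : (x.J - x.R) * Xᵀ + Xᵀ * Aᵀ + x.B * Bᵀ = 0 := by
    have := congrArg Matrix.transpose hX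
    simp only [transpose_add, transpose_mul, transpose_transpose, transpose_zero] at this
    rw [← this]
    abel
  have hZ : fromBlocks A 0 0 (x.J - x.R) * fromBlocks W X Xᵀ P
      + fromBlocks W X Xᵀ P * (fromBlocks A 0 0 (x.J - x.R))ᵀ
      + fromRows B x.B * (fromRows B x.B)ᵀ = 0 := by
    rw [fromBlocks_transpose, transpose_fromRows, fromRows_mul_fromCols, fromBlocks_multiply,
      fromBlocks_multiply, fromBlocks_add, fromBlocks_add]
    simp only [Matrix.zero_mul, Matrix.mul_zero, transpose_zero, add_zero, zero_add, hW, hX, hP,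
      hX', fromBlocks_zero]
  have hblock := fun s hs => errorTransfer_eq_block B C x (s := s) (hA.isUnit_smul_one_sub hs)
    (hx.isUnit_smul_one_sub hs)
  obtain ⟨h1, h2⟩ := integrable_and_integral_frobNorm_sq (fromCols C (-x.C))
    (fun s hs => (hblock s hs).1) hZ
  have hI : ∀ t : ℝ, errorTransfer A B C x (Complex.I * t) = _ := fun t =>
    (hblock (Complex.I * t) (by simp)).2
  simp only [← hI] at h1 h2
  refine ⟨h1, ?_⟩
  have hpos : 0 ≤ 1 / (2 * Real.pi)
      * ∫ t : ℝ, frobNorm (errorTransfer A B C x (Complex.I * t)) ^ 2 :=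
    mul_nonneg (by positivity) (integral_nonneg fun t => sq_nonneg _)
  rw [objective, h2Norm, Real.sq_sqrt hpos, h2]
  have htr : (fromCols C (-x.C) * fromBlocks W X Xᵀ P * (fromCols C (-x.C))ᵀ).trace
      = (C * W * Cᵀ).trace - 2 * (C * X * x.Cᵀ).trace + (x.C * P * x.Cᵀ).trace := by
    have e : (x.C * (Xᵀ * Cᵀ)).trace = (C * (X * x.Cᵀ)).trace := by
      rw [← trace_transpose]
      simp [Matrix.mul_assoc]
    rw [transpose_fromCols, fromCols_mul_fromBlocks, fromCols_mul_fromRows]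
    simp only [transpose_neg, Matrix.add_mul, Matrix.mul_neg, Matrix.neg_mul, trace_add, trace_neg,
      Matrix.mul_assoc, e]
    ring
  rw [htr]
  field_simp

/-! ### Calculus on the manifold -/

namespace PHSpace

variable {r m p : ℕ}

theorem transpose_J (x : PHSpace r m p) : x.Jᵀ = -x.J := (Prod.fst x : SkewMat r).2

theorem isDissipative_sub {x : PHSpace r m p} (hx : x ∈ PHManifold r m p) :
    IsDissipative (x.J - x.R) :=
  .sub_of_skew x.transpose_J hx

theorem contDiff_J : ContDiff ℝ ∞ (J : PHSpace r m p → Matrix (Fin r) (Fin r) ℝ) :=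
  ((SkewMat r).subtypeL.contDiff).comp (contDiff_fst (E := SkewMat r)
    (F := SymMat r × Matrix (Fin r) (Fin m) ℝ × Matrix (Fin p) (Fin r) ℝ))

theorem contDiff_B : ContDiff ℝ ∞ (B : PHSpace r m p → Matrix (Fin r) (Fin m) ℝ) :=
  (contDiff_fst (E := Matrix (Fin r) (Fin m) ℝ) (F := Matrix (Fin p) (Fin r) ℝ)).comp
    ((contDiff_snd (E := SymMat r)).comp (contDiff_snd (E := SkewMat r)))

theorem contDiff_C : ContDiff ℝ ∞ (C : PHSpace r m p → Matrix (Fin p) (Fin r) ℝ) :=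
  (contDiff_snd (E := Matrix (Fin r) (Fin m) ℝ) (F := Matrix (Fin p) (Fin r) ℝ)).comp
    ((contDiff_snd (E := SymMat r)).comp (contDiff_snd (E := SkewMat r)))

section Line

theorem hasDerivAt_add_smul {α β : Type*} [Fintype β] (M N : Matrix α β ℝ) (t : ℝ) :
    HasDerivAt (fun u : ℝ => M + u • N) N t :=
  .of_matrix_apply fun i j => by
    simpa using ((hasDerivAt_id t).mul_const (N i j)).const_add (M i j)

variable (x v : PHSpace r m p)

theorem hasDerivAt_J : HasDerivAt (fun t : ℝ => (x + t • v).J) v.J 0 :=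
  hasDerivAt_add_smul x.J v.J 0

theorem hasDerivAt_R : HasDerivAt (fun t : ℝ => (x + t • v).R) v.R 0 :=
  hasDerivAt_add_smul x.R v.R 0

theorem hasDerivAt_B : HasDerivAt (fun t : ℝ => (x + t • v).B) v.B 0 :=
  hasDerivAt_add_smul x.B v.B 0

theorem hasDerivAt_C : HasDerivAt (fun t : ℝ => (x + t • v).C) v.C 0 :=
  hasDerivAt_add_smul x.C v.C 0

theorem hasDerivAt_sub : HasDerivAt (fun t : ℝ => (x + t • v).J - (x + t • v).R) (v.J - v.R) 0 :=
  (hasDerivAt_J x v).sub (hasDerivAt_R x v)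

variable {x}

/-- Reduces Fréchet derivatives to derivatives along lines, where the one-variable product rule for
matrices is available. -/
theorem hasDerivAt_line {F : Type*} [NormedAddCommGroup F] [NormedSpace ℝ F]
    {f : PHSpace r m p → F} (hf : ContDiffAt ℝ ∞ f x) :
    HasDerivAt (fun t : ℝ => f (x + t • v)) (fderiv ℝ f x v) 0 :=
  (hf.differentiableAt (by simp)).hasFDerivAt.hasLineDerivAt v

theorem exists_hasDerivAt_line {α β : Type*} [Fintype α] [Fintype β]
    {f : PHSpace r m p → Matrix α β ℝ} (hf : ContDiffAt ℝ ∞ f x) :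
    ∃ f' : Matrix α β ℝ, HasDerivAt (fun t : ℝ => f (x + t • v)) f' 0 :=
  ⟨_, hasDerivAt_line v hf⟩

theorem eventually_line_mem (hx : x ∈ PHManifold r m p) :
    ∀ᶠ t : ℝ in nhds 0, x + t • v ∈ PHManifold r m p := by
  have hc : ContinuousAt (fun t : ℝ => x + t • v) 0 := by fun_prop
  exact hc.eventually_mem (by simpa using (isOpen_phManifold r m p).mem_nhds hx)

end Line

/-- `R⁻¹` is the solution `Z` of `-R Z - Z R + 2 = 0`, so the smoothness of Sylvester solutions
applies. -/
theorem contDiffAt_inv_R {x : PHSpace r m p} (hx : x ∈ PHManifold r m p) :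
    ContDiffAt ℝ ∞ (fun y : PHSpace r m p => y.R⁻¹) x := by
  have hd : ∀ y ∈ PHManifold r m p, IsDissipative (-y.R) := fun y hy => by
    have := IsDissipative.sub_of_skew (J := 0) (by simp) hy
    rwa [zero_sub] at this
  have h : ContDiffAt ℝ ∞ (fun y : PHSpace r m p =>
      sylvesterSol (-y.R) (-y.R) ((2 : ℝ) • (1 : Matrix (Fin r) (Fin r) ℝ))) x :=
    .sylvesterSol contDiff_R.contDiffAt.neg contDiff_R.contDiffAt.neg contDiffAt_const
      (hd x hx) (hd x hx)
  refine h.congr_of_eventuallyEq ?_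
  filter_upwards [(isOpen_phManifold r m p).mem_nhds hx] with y hy
  rw [eq_sylvesterSol_iff (hd y hy) (hd y hy)]
  have hu : IsUnit y.R.det := (PosDef.det_pos hy).ne'.isUnit
  rw [Matrix.neg_mul, Matrix.mul_neg, mul_nonsing_inv _ hu, nonsing_inv_mul _ hu, two_smul]
  abel

theorem hasDerivAt_inv_R {x : PHSpace r m p} (hx : x ∈ PHManifold r m p) (v : PHSpace r m p) :
    HasDerivAt (fun t : ℝ => (x + t • v).R⁻¹) (-(x.R⁻¹ * v.R * x.R⁻¹)) 0 := by
  have hu : IsUnit x.R.det := (PosDef.det_pos hx).ne'.isUnit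
  obtain ⟨D, h⟩ := exists_hasDerivAt_line v (contDiffAt_inv_R hx)
  have h1 := (hasDerivAt_R x v).matMul h
  have h2 : (fun t : ℝ => (x + t • v).R * (x + t • v).R⁻¹) =ᶠ[nhds 0] fun _ => 1 := by
    filter_upwards [eventually_line_mem v hx] with t ht
    exact mul_nonsing_inv _ (PosDef.det_pos ht).ne'.isUnit
  have h3 := (h1.congr_of_eventuallyEq h2.symm).unique (hasDerivAt_const (0 : ℝ) _)
  simp only [zero_smul, add_zero] at h3
  have h4 : D = -(x.R⁻¹ * v.R * x.R⁻¹) := by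
    rw [← nonsing_inv_mul_cancel_left (A := x.R) D hu, eq_neg_of_add_eq_zero_right h3,
      Matrix.mul_neg, Matrix.mul_assoc]
  rwa [h4] at h

/-- The point with components `sk(M₁)`, `sym(M₂)`, `M₃`, `M₄`. -/
noncomputable def ofMatrices : (Matrix (Fin r) (Fin r) ℝ × Matrix (Fin r) (Fin r) ℝ ×
    Matrix (Fin r) (Fin m) ℝ × Matrix (Fin p) (Fin r) ℝ) →ₗ[ℝ] PHSpace r m p where
  toFun z := (⟨skPart z.1, by
      show (skPart z.1)ᵀ = -skPart z.1
      simp [skPart, ← smul_neg]⟩, ⟨symPart z.2.1, by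
      show (symPart z.2.1)ᵀ = symPart z.2.1
      simp [symPart, add_comm]⟩, z.2.2.1, z.2.2.2)
  map_add' z w := PHSpace.ext
    (show skPart (z.1 + w.1) = skPart z.1 + skPart w.1 by
      simp only [skPart, transpose_add, ← smul_add]; congr 1; abel)
    (show symPart (z.2.1 + w.2.1) = symPart z.2.1 + symPart w.2.1 by
      simp only [symPart, transpose_add, ← smul_add]; congr 1; abel) rfl rfl
  map_smul' c z := PHSpace.ext
    (show skPart (c • z.1) = c • skPart z.1 by
      simp only [skPart, transpose_smul, ← smul_sub, smul_comm c])
    (show symPart (c • z.2.1) = c • symPart z.2.1 by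
      simp only [symPart, transpose_smul, ← smul_add, smul_comm c]) rfl rfl

section

variable (M₁ M₂ : Matrix (Fin r) (Fin r) ℝ) (M₃ : Matrix (Fin r) (Fin m) ℝ)
  (M₄ : Matrix (Fin p) (Fin r) ℝ)

@[simp] theorem J_ofMatrices : (ofMatrices (M₁, M₂, M₃, M₄)).J = skPart M₁ := rfl

@[simp] theorem R_ofMatrices : (ofMatrices (M₁, M₂, M₃, M₄)).R = symPart M₂ := rfl

@[simp] theorem B_ofMatrices : (ofMatrices (M₁, M₂, M₃, M₄)).B = M₃ := rfl

@[simp] theorem C_ofMatrices : (ofMatrices (M₁, M₂, M₃, M₄)).C = M₄ := rfl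

end

theorem hasDerivAt_ofMatrices {M₁ M₂ : ℝ → Matrix (Fin r) (Fin r) ℝ}
    {M₃ : ℝ → Matrix (Fin r) (Fin m) ℝ} {M₄ : ℝ → Matrix (Fin p) (Fin r) ℝ}
    {M₁' M₂' : Matrix (Fin r) (Fin r) ℝ} {M₃' : Matrix (Fin r) (Fin m) ℝ}
    {M₄' : Matrix (Fin p) (Fin r) ℝ} {t : ℝ} (h₁ : HasDerivAt M₁ M₁' t) (h₂ : HasDerivAt M₂ M₂' t)
    (h₃ : HasDerivAt M₃ M₃' t) (h₄ : HasDerivAt M₄ M₄' t) :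
    HasDerivAt (fun u => ofMatrices (M₁ u, M₂ u, M₃ u, M₄ u)) (ofMatrices (M₁', M₂', M₃', M₄')) t :=
  (LinearMap.toContinuousLinearMap
    (ofMatrices (r := r) (m := m) (p := p))).hasFDerivAt.comp_hasDerivAt t
    (h₁.prodMk (h₂.prodMk (h₃.prodMk h₄)))

theorem contDiffAt_ofMatrices {x : PHSpace r m p} {M₁ M₂ : PHSpace r m p → Matrix (Fin r) (Fin r) ℝ}
    {M₃ : PHSpace r m p → Matrix (Fin r) (Fin m) ℝ} {M₄ : PHSpace r m p → Matrix (Fin p) (Fin r) ℝ}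
    (h₁ : ContDiffAt ℝ ∞ M₁ x) (h₂ : ContDiffAt ℝ ∞ M₂ x) (h₃ : ContDiffAt ℝ ∞ M₃ x)
    (h₄ : ContDiffAt ℝ ∞ M₄ x) :
    ContDiffAt ℝ ∞ (fun y => ofMatrices (M₁ y, M₂ y, M₃ y, M₄ y)) x :=
  (LinearMap.toContinuousLinearMap
    (ofMatrices (r := r) (m := m) (p := p))).contDiff.contDiffAt.comp x
    (h₁.prodMk (h₂.prodMk (h₃.prodMk h₄)))

end PHSpace

/-- The Christoffel map of the product metric. -/
theorem christoffel_phMetric {r m p : ℕ} {x : PHSpace r m p} (hx : x ∈ PHManifold r m p)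
    (u v : PHSpace r m p) :
    (phMetric r m p).christoffel x u v = PHSpace.ofMatrices (0,
      (-(1 / 2) : ℝ) • (u.R * x.R⁻¹ * v.R + v.R * x.R⁻¹ * u.R), 0, 0) := by
  have hd : ContDiffAt ℝ ∞ (phForm (r := r) (m := m) (p := p)) x :=
    (contDiffOn_phForm r m p).contDiffAt ((isOpen_phManifold r m p).mem_nhds hx)
  have hD : ∀ a b c : PHSpace r m p, fderiv ℝ phForm x a b c
      = -(x.R⁻¹ * a.R * x.R⁻¹ * b.R * x.R⁻¹ * c.R).trace
        - (x.R⁻¹ * b.R * x.R⁻¹ * a.R * x.R⁻¹ * c.R).trace := by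
    intro a b c
    have h1 : HasDerivAt (fun t : ℝ => phForm (x + t • a) b c) (fderiv ℝ phForm x a b c) 0 := by
      simpa using ((PHSpace.hasDerivAt_line a hd).clm_apply (hasDerivAt_const (0 : ℝ) b)).clm_apply
        (hasDerivAt_const (0 : ℝ) c)
    have hR := PHSpace.hasDerivAt_inv_R hx a
    have h2 := ((((hR.matMul (hasDerivAt_const (0 : ℝ) b.R)).matMul hR).matMul
      (hasDerivAt_const (0 : ℝ) c.R)).matTrace.const_add ((b.Jᵀ * c.J).trace)).add_const
        (b.Bᵀ * c.B).trace |>.add_const (b.Cᵀ * c.C).trace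
    rw [h1.unique h2]
    simp [Matrix.add_mul, Matrix.mul_assoc, sub_eq_add_neg]
  have hu : IsUnit x.R.det := (PosDef.det_pos hx).ne'.isUnit
  rw [RiemannianMetricOn.christoffel, eq_comm, ← inv_smul_eq_iff₀ (by norm_num),
    RiemannianMetricOn.eq_sharp_iff _ hx]
  intro w
  -- The candidate is already symmetric, so the projection inside `ofMatrices` leaves it alone.
  have hsym : symPart ((-(1 / 2) : ℝ) • (u.R * x.R⁻¹ * v.R + v.R * x.R⁻¹ * u.R))
      = (-(1 / 2) : ℝ) • (u.R * x.R⁻¹ * v.R + v.R * x.R⁻¹ * u.R) := by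
    have : x.R⁻¹ᵀ = x.R⁻¹ := by rw [transpose_nonsing_inv, x.transpose_R]
    simp only [symPart, transpose_smul, transpose_add, transpose_mul, this, u.transpose_R,
      v.transpose_R, Matrix.mul_assoc]
    module
  -- Cyclic rotation moves `w` to the last place; in the Koszul sum the `D_w` term then cancels one
  -- of the two equal remaining terms.
  have hcyc : ∀ a b : PHSpace r m p, (x.R⁻¹ * w.R * x.R⁻¹ * a.R * x.R⁻¹ * b.R).trace
      = (x.R⁻¹ * a.R * x.R⁻¹ * b.R * x.R⁻¹ * w.R).trace := fun a b => by
    rw [Matrix.mul_assoc, Matrix.mul_assoc, Matrix.mul_assoc, trace_mul_comm]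
    simp only [Matrix.mul_assoc]
  have hcyc' : ∀ a b : PHSpace r m p, (x.R⁻¹ * a.R * x.R⁻¹ * w.R * x.R⁻¹ * b.R).trace
      = (x.R⁻¹ * b.R * x.R⁻¹ * a.R * x.R⁻¹ * w.R).trace := fun a b => by
    rw [Matrix.mul_assoc, trace_mul_comm]
    simp only [Matrix.mul_assoc]
  simp only [phMetric, map_smul, _root_.sub_apply, _root_.add_apply, _root_.smul_apply,
    ContinuousLinearMap.flip_apply, hD, hcyc, hcyc', phForm_apply, PHSpace.J_ofMatrices,
    PHSpace.R_ofMatrices, PHSpace.B_ofMatrices, PHSpace.C_ofMatrices, hsym]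
  simp [skPart, Matrix.mul_add, Matrix.add_mul, ← Matrix.mul_assoc]
  ring

/-! ### The Gramians and their derivatives -/

/-- By the product rule the derivative of a solution solves the same Sylvester equation with a new
inhomogeneity, and so is determined by it. -/
theorem sylvester_hasDerivAt {ι κ : Type*} [Fintype ι] [Fintype κ] {A : ℝ → Matrix ι ι ℝ}
    {B : ℝ → Matrix κ κ ℝ} {K S : ℝ → Matrix ι κ ℝ} {A' : Matrix ι ι ℝ} {B' : Matrix κ κ ℝ}
    {K' S' : Matrix ι κ ℝ} {t : ℝ} (hA : HasDerivAt A A' t) (hB : HasDerivAt B B' t)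
    (hK : HasDerivAt K K' t) (hS : HasDerivAt S S' t)
    (h : ∀ᶠ u in nhds t, A u * S u + S u * B u + K u = 0) :
    A t * S' + S' * B t + (A' * S t + S t * B' + K') = 0 := by
  have h1 := ((hA.matMul hS).add (hS.matMul hB)).add hK
  have h2 := (h1.congr_of_eventuallyEq (h.mono fun u hu => hu.symm)).unique
    (hasDerivAt_const t (0 : Matrix ι κ ℝ))
  rw [← h2]
  abel

/-- The duality between a Sylvester equation and its adjoint. -/
theorem trace_transpose_mul_sylvester {ι κ : Type*} [Fintype ι] [Fintype κ] {A : Matrix ι ι ℝ}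
    {B : Matrix κ κ ℝ} {K L X Y : Matrix ι κ ℝ} (hX : A * X + X * B + K = 0)
    (hY : Aᵀ * Y + Y * Bᵀ + L = 0) : (Lᵀ * X).trace = (Yᵀ * K).trace := by
  have hK : K = -(A * X + X * B) := eq_neg_of_add_eq_zero_right hX
  have hL : L = -(Aᵀ * Y + Y * Bᵀ) := eq_neg_of_add_eq_zero_right hY
  rw [hK, hL]
  simp only [transpose_neg, transpose_add, transpose_mul, transpose_transpose, Matrix.neg_mul,
    Matrix.mul_neg, Matrix.add_mul, Matrix.mul_add, trace_neg, trace_add, Matrix.mul_assoc]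
  rw [trace_mul_comm B, Matrix.mul_assoc]

theorem trace_transpose_mul_comm {α β : Type*} [Fintype α] [Fintype β] (M N : Matrix α β ℝ) :
    (Mᵀ * N).trace = (Nᵀ * M).trace := by
  rw [← trace_transpose, transpose_mul, transpose_transpose]

theorem trace_mul_mul_transpose {α β γ : Type*} [Fintype α] [Fintype β] [Fintype γ]
    (M : Matrix α γ ℝ) (N : Matrix γ β ℝ) (K : Matrix α β ℝ) :
    (M * (N * Kᵀ)).trace = ((M * N)ᵀ * K).trace := by
  rw [trace_transpose_mul_comm, ← Matrix.mul_assoc, trace_mul_comm]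

noncomputable section

variable {n r m p : ℕ}

/-- The reachability Gramian of the reduced system. -/
def gramP (x : PHSpace r m p) : Matrix (Fin r) (Fin r) ℝ :=
  sylvesterSol (x.J - x.R) (x.J - x.R)ᵀ (x.B * x.Bᵀ)

/-- The observability Gramian of the reduced system. -/
def gramQ (x : PHSpace r m p) : Matrix (Fin r) (Fin r) ℝ :=
  sylvesterSol (x.J - x.R)ᵀ (x.J - x.R) (x.Cᵀ * x.C)

/-- The solution `X` of the mixed Sylvester equation of reachability. -/
def gramX (At : Matrix (Fin n) (Fin n) ℝ) (Bt : Matrix (Fin n) (Fin m) ℝ) (x : PHSpace r m p) :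
    Matrix (Fin n) (Fin r) ℝ :=
  sylvesterSol At (x.J - x.R)ᵀ (Bt * x.Bᵀ)

/-- The solution `Y` of the mixed Sylvester equation of observability. -/
def gramY (At : Matrix (Fin n) (Fin n) ℝ) (Ct : Matrix (Fin p) (Fin n) ℝ) (x : PHSpace r m p) :
    Matrix (Fin n) (Fin r) ℝ :=
  sylvesterSol Atᵀ (x.J - x.R) (-(Ctᵀ * x.C))

variable {At : Matrix (Fin n) (Fin n) ℝ} {Bt : Matrix (Fin n) (Fin m) ℝ}
  {Ct : Matrix (Fin p) (Fin n) ℝ} {x : PHSpace r m p}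

theorem solvesGramEqs_iff (hAt : IsDissipative At) (hx : x ∈ PHManifold r m p)
    {P Q : Matrix (Fin r) (Fin r) ℝ} {X Y : Matrix (Fin n) (Fin r) ℝ} :
    SolvesGramEqs At Bt Ct x P Q X Y ↔
      P = gramP x ∧ Q = gramQ x ∧ X = gramX At Bt x ∧ Y = gramY At Ct x := by
  have hA := PHSpace.isDissipative_sub hx
  rw [gramP, gramQ, gramX, gramY, eq_sylvesterSol_iff hA hA.transpose,
    eq_sylvesterSol_iff hA.transpose hA, eq_sylvesterSol_iff hAt hA.transpose,
    eq_sylvesterSol_iff hAt.transpose hA, ← sub_eq_add_neg]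
  exact ⟨fun h => ⟨h.1, h.2, h.3, h.4⟩, fun h => ⟨h.1, h.2.1, h.2.2.1, h.2.2.2⟩⟩

theorem solvesDerivGramEqs_iff (hAt : IsDissipative At) (hx : x ∈ PHManifold r m p)
    {v : PHSpace r m p} {P Q P' Q' : Matrix (Fin r) (Fin r) ℝ}
    {X Y X' Y' : Matrix (Fin n) (Fin r) ℝ} :
    SolvesDerivGramEqs At Bt Ct x v P Q X Y P' Q' X' Y' ↔
      P' = sylvesterSol (x.J - x.R) (x.J - x.R)ᵀ
        ((v.J - v.R) * P + P * (v.J - v.R)ᵀ + (v.B * x.Bᵀ + x.B * v.Bᵀ)) ∧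
      Q' = sylvesterSol (x.J - x.R)ᵀ (x.J - x.R)
        ((v.J - v.R)ᵀ * Q + Q * (v.J - v.R) + (v.Cᵀ * x.C + x.Cᵀ * v.C)) ∧
      X' = sylvesterSol At (x.J - x.R)ᵀ (X * (v.J - v.R)ᵀ + Bt * v.Bᵀ) ∧
      Y' = sylvesterSol Atᵀ (x.J - x.R) (Y * (v.J - v.R) + -(Ctᵀ * v.C)) := by
  have hA := PHSpace.isDissipative_sub hx
  rw [eq_sylvesterSol_iff hA hA.transpose, eq_sylvesterSol_iff hA.transpose hA,
    eq_sylvesterSol_iff hAt hA.transpose, eq_sylvesterSol_iff hAt.transpose hA]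
  simp only [← add_assoc, ← sub_eq_add_neg, ← add_sub_assoc]
  exact ⟨fun h => ⟨h.1, h.2, h.3, h.4⟩, fun h => ⟨h.1, h.2.1, h.2.2.1, h.2.2.2⟩⟩

section Smooth

open PHSpace

theorem contDiffAt_sub : ContDiffAt ℝ ∞ (fun y : PHSpace r m p => y.J - y.R) x :=
  contDiff_J.contDiffAt.sub contDiff_R.contDiffAt

theorem contDiffAt_gramP (hx : x ∈ PHManifold r m p) :
    ContDiffAt ℝ ∞ (gramP : PHSpace r m p → _) x :=
  .sylvesterSol contDiffAt_sub contDiffAt_sub.matTranspose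
    (contDiff_B.contDiffAt.matMul contDiff_B.contDiffAt.matTranspose) (isDissipative_sub hx)
    (isDissipative_sub hx).transpose

theorem contDiffAt_gramQ (hx : x ∈ PHManifold r m p) :
    ContDiffAt ℝ ∞ (gramQ : PHSpace r m p → _) x :=
  .sylvesterSol contDiffAt_sub.matTranspose contDiffAt_sub
    (contDiff_C.contDiffAt.matTranspose.matMul contDiff_C.contDiffAt)
    (isDissipative_sub hx).transpose (isDissipative_sub hx)

theorem contDiffAt_gramX (hAt : IsDissipative At) (hx : x ∈ PHManifold r m p) :
    ContDiffAt ℝ ∞ (gramX At Bt : PHSpace r m p → _) x :=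
  .sylvesterSol contDiffAt_const contDiffAt_sub.matTranspose
    (contDiffAt_const.matMul contDiff_B.contDiffAt.matTranspose) hAt
    (isDissipative_sub hx).transpose

theorem contDiffAt_gramY (hAt : IsDissipative At) (hx : x ∈ PHManifold r m p) :
    ContDiffAt ℝ ∞ (gramY At Ct : PHSpace r m p → _) x :=
  .sylvesterSol contDiffAt_const contDiffAt_sub
    (contDiffAt_const.matMul contDiff_C.contDiffAt).neg hAt.transpose (isDissipative_sub hx)

/-- The solutions of the differentiated equations are the derivatives of the Gramians. -/
theorem hasDerivAt_gram (hAt : IsDissipative At) (hx : x ∈ PHManifold r m p) {v : PHSpace r m p}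
    {P' Q' : Matrix (Fin r) (Fin r) ℝ} {X' Y' : Matrix (Fin n) (Fin r) ℝ}
    (h : SolvesDerivGramEqs At Bt Ct x v (gramP x) (gramQ x) (gramX At Bt x) (gramY At Ct x)
      P' Q' X' Y') :
    HasDerivAt (fun t : ℝ => gramP (x + t • v)) P' 0 ∧
      HasDerivAt (fun t : ℝ => gramQ (x + t • v)) Q' 0 ∧
      HasDerivAt (fun t : ℝ => gramX At Bt (x + t • v)) X' 0 ∧
      HasDerivAt (fun t : ℝ => gramY At Ct (x + t • v)) Y' 0 := by
  have hA := isDissipative_sub hx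
  have hmem := (eventually_line_mem v hx).mono fun t ht => isDissipative_sub ht
  rw [solvesDerivGramEqs_iff hAt hx] at h
  obtain ⟨rfl, rfl, rfl, rfl⟩ := h
  have dA := hasDerivAt_sub x v
  have dB := hasDerivAt_B x v
  have dC := hasDerivAt_C x v
  refine ⟨?_, ?_, ?_, ?_⟩
  · obtain ⟨D, hD⟩ := exists_hasDerivAt_line v (contDiffAt_gramP hx)
    have e := sylvester_hasDerivAt dA dA.matTranspose (dB.matMul dB.matTranspose) hD
      (hmem.mono fun t ht => sylvesterSol_spec ht ht.transpose _)
    simp only [zero_smul, add_zero] at e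
    rw [← eq_sylvesterSol_iff hA hA.transpose] at e
    rwa [← e]
  · obtain ⟨D, hD⟩ := exists_hasDerivAt_line v (contDiffAt_gramQ hx)
    have e := sylvester_hasDerivAt dA.matTranspose dA (dC.matTranspose.matMul dC) hD
      (hmem.mono fun t ht => sylvesterSol_spec ht.transpose ht _)
    simp only [zero_smul, add_zero] at e
    rw [← eq_sylvesterSol_iff hA.transpose hA] at e
    rwa [← e]
  · obtain ⟨D, hD⟩ := exists_hasDerivAt_line v (contDiffAt_gramX (Bt := Bt) hAt hx)
    have e := sylvester_hasDerivAt (hasDerivAt_const (0 : ℝ) At) dA.matTranspose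
      ((hasDerivAt_const (0 : ℝ) Bt).matMul dB.matTranspose) hD
      (hmem.mono fun t ht => sylvesterSol_spec hAt ht.transpose _)
    simp only [zero_smul, add_zero, Matrix.zero_mul, zero_add] at e
    rw [← eq_sylvesterSol_iff hAt hA.transpose] at e
    rwa [← e]
  · obtain ⟨D, hD⟩ := exists_hasDerivAt_line v (contDiffAt_gramY (Ct := Ct) hAt hx)
    have e := sylvester_hasDerivAt (hasDerivAt_const (0 : ℝ) Atᵀ) dA
      ((hasDerivAt_const (0 : ℝ) Ctᵀ).matMul dC).neg hD
      (hmem.mono fun t ht => sylvesterSol_spec hAt.transpose ht _)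
    simp only [zero_smul, add_zero, Matrix.zero_mul, zero_add] at e
    rw [← eq_sylvesterSol_iff hAt.transpose hA] at e
    rwa [← e]

end Smooth

/-- The transpose solves the same equation, so uniqueness applies. -/
theorem transpose_gramP (hx : x ∈ PHManifold r m p) : (gramP x)ᵀ = gramP x := by
  have hA := PHSpace.isDissipative_sub hx
  have h := congrArg Matrix.transpose (sylvesterSol_spec hA hA.transpose (x.B * x.Bᵀ))
  refine (eq_sylvesterSol_iff hA hA.transpose).2 (Eq.trans ?_ h)
  simp only [transpose_add, transpose_mul, transpose_transpose, gramP]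
  abel

theorem transpose_gramQ (hx : x ∈ PHManifold r m p) : (gramQ x)ᵀ = gramQ x := by
  have hA := PHSpace.isDissipative_sub hx
  have h := congrArg Matrix.transpose (sylvesterSol_spec hA.transpose hA (x.Cᵀ * x.C))
  refine (eq_sylvesterSol_iff hA.transpose hA).2 (Eq.trans ?_ h)
  simp only [transpose_add, transpose_mul, transpose_transpose, gramQ]
  abel

/-! ### The objective function, its gradient and its Hessian -/

theorem integrable_and_objective_eq_gram (hAt : IsDissipative At) (hx : x ∈ PHManifold r m p) :
    Integrable (fun t : ℝ => frobNorm (errorTransfer At Bt Ct x (Complex.I * t)) ^ 2) ∧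
      objective At Bt Ct x = (Ct * sylvesterSol At Atᵀ (Bt * Btᵀ) * Ctᵀ).trace
        - 2 * (Ct * gramX At Bt x * x.Cᵀ).trace + (x.C * gramP x * x.Cᵀ).trace :=
  have hA := PHSpace.isDissipative_sub hx
  integrable_and_objective_eq hAt Ct hA (sylvesterSol_spec hAt hAt.transpose _)
    (sylvesterSol_spec hAt hA.transpose _) (sylvesterSol_spec hA hA.transpose _)

theorem contDiffAt_objective (hAt : IsDissipative At) (hx : x ∈ PHManifold r m p) :
    ContDiffAt ℝ ∞ (objective (r := r) At Bt Ct) x := by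
  have hC := (PHSpace.contDiff_C (r := r) (m := m) (p := p)).contDiffAt (x := x)
  have h := ((contDiffAt_const (c := (Ct * sylvesterSol At Atᵀ (Bt * Btᵀ) * Ctᵀ).trace)).sub
    (contDiffAt_const (c := (2 : ℝ)).mul ((contDiffAt_const (c := Ct)).matMul
      (contDiffAt_gramX (Bt := Bt) hAt hx) |>.matMul hC.matTranspose).matTrace)).add
    (hC.matMul (contDiffAt_gramP hx) |>.matMul hC.matTranspose).matTrace
  refine h.congr_of_eventuallyEq ?_
  filter_upwards [(isOpen_phManifold r m p).mem_nhds hx] with y hy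
  exact (integrable_and_objective_eq_gram hAt hy).2

/-- The matrix `Q P + Yᵀ X`. -/
def gramS (At : Matrix (Fin n) (Fin n) ℝ) (Bt : Matrix (Fin n) (Fin m) ℝ)
    (Ct : Matrix (Fin p) (Fin n) ℝ) (x : PHSpace r m p) : Matrix (Fin r) (Fin r) ℝ :=
  gramQ x * gramP x + (gramY At Ct x)ᵀ * gramX At Bt x

/-- The adjoint method: `P'` and `X'` enter only through traces against `CᵀC` and `CᵀCt`, the
inhomogeneities of the `Q` and `Y` equations up to transpose and sign. Duality replaces these traces
by ones that are explicit in `v`. -/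
theorem fderiv_objective (hAt : IsDissipative At) (hx : x ∈ PHManifold r m p)
    (v : PHSpace r m p) :
    fderiv ℝ (objective At Bt Ct) x v = 2 * (((gramS At Bt Ct x)ᵀ * (v.J - v.R)).trace
      + ((gramQ x * x.B + (gramY At Ct x)ᵀ * Bt)ᵀ * v.B).trace
      + ((x.C * gramP x - Ct * gramX At Bt x)ᵀ * v.C).trace) := by
  have hA := PHSpace.isDissipative_sub hx
  have hS := (solvesDerivGramEqs_iff (Bt := Bt) (Ct := Ct) hAt hx (v := v) (P := gramP x)
    (Q := gramQ x) (X := gramX At Bt x) (Y := gramY At Ct x)).2 ⟨rfl, rfl, rfl, rfl⟩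
  obtain ⟨hP, -, hX, -⟩ := hasDerivAt_gram hAt hx hS
  obtain ⟨eP, -, eX, -⟩ := (solvesDerivGramEqs_iff hAt hx).1 hS
  rw [eq_sylvesterSol_iff hA hA.transpose] at eP
  rw [eq_sylvesterSol_iff hAt hA.transpose] at eX
  set P' := sylvesterSol (x.J - x.R) (x.J - x.R)ᵀ
        ((v.J - v.R) * gramP x + gramP x * (v.J - v.R)ᵀ + (v.B * x.Bᵀ + x.B * v.Bᵀ))
  set X' := sylvesterSol At (x.J - x.R)ᵀ (gramX At Bt x * (v.J - v.R)ᵀ + Bt * v.Bᵀ)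
  -- The double transpose matches the adjoint form expected by `trace_transpose_mul_sylvester`.
  have sQ : (x.J - x.R)ᵀ * gramQ x + gramQ x * (x.J - x.R)ᵀᵀ + x.Cᵀ * x.C = 0 := by
    rw [transpose_transpose]
    exact sylvesterSol_spec hA.transpose hA _
  have sY : Atᵀ * gramY At Ct x + gramY At Ct x * (x.J - x.R)ᵀᵀ + -(Ctᵀ * x.C) = 0 := by
    rw [transpose_transpose]
    exact sylvesterSol_spec hAt.transpose hA _
  have d1 := trace_transpose_mul_sylvester eP sQ
  have d2 := trace_transpose_mul_sylvester eX sY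
  have dC := PHSpace.hasDerivAt_C x v
  have hd := ((((hasDerivAt_const (0 : ℝ) Ct).matMul hX).matMul dC.matTranspose).matTrace.const_mul
    2 |>.const_sub (Ct * sylvesterSol At Atᵀ (Bt * Btᵀ) * Ctᵀ).trace).add
    ((dC.matMul hP).matMul dC.matTranspose).matTrace
  have hd' := hd.congr_of_eventuallyEq (f₁ := fun t : ℝ => objective At Bt Ct (x + t • v)) <| by
    filter_upwards [PHSpace.eventually_line_mem v hx] with t ht
    exact (integrable_and_objective_eq_gram hAt ht).2
  rw [(PHSpace.hasDerivAt_line v (contDiffAt_objective hAt hx)).unique hd']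
  simp only [zero_smul, add_zero, Matrix.zero_mul, zero_add]
  set P := gramP x
  set Q := gramQ x
  set X := gramX At Bt x
  set Y := gramY At Ct x
  set D := v.J - v.R
  have hPt : Pᵀ = P := transpose_gramP hx
  have hQt : Qᵀ = Q := transpose_gramQ hx
  -- The minus sign in the equation for `Y` turns the term `-2 tr(Ct X' Cᵀ)` into `+2 tr(Yᵀ K)`,
  -- with `K` the inhomogeneity of the equation for `X'`.
  simp only [transpose_mul, transpose_neg, transpose_transpose, hQt, Matrix.mul_add, trace_add,
    Matrix.neg_mul, trace_neg] at d1 d2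
  have e1 : (x.C * P' * x.Cᵀ).trace = (x.Cᵀ * x.C * P').trace := by
    rw [trace_mul_comm, Matrix.mul_assoc]
  have e2 : (Ct * X' * x.Cᵀ).trace = (x.Cᵀ * Ct * X').trace := by
    rw [trace_mul_comm, Matrix.mul_assoc]
  have e3 : (Q * (D * P)).trace = ((Q * P)ᵀ * D).trace := by
    rw [transpose_mul, hPt, hQt, Matrix.mul_assoc, trace_mul_comm P, Matrix.mul_assoc]
  have e4 := trace_mul_mul_transpose Q P D
  have e5 : (Q * (v.B * x.Bᵀ)).trace = ((Q * x.B)ᵀ * v.B).trace := by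
    rw [transpose_mul, hQt, Matrix.mul_assoc, trace_mul_comm x.Bᵀ, Matrix.mul_assoc]
  have e6 := trace_mul_mul_transpose Q x.B v.B
  have e7 := trace_mul_mul_transpose Yᵀ X D
  have e8 := trace_mul_mul_transpose Yᵀ Bt v.B
  have e9 : (Ct * X * v.Cᵀ).trace = ((Ct * X)ᵀ * v.C).trace := by
    rw [trace_transpose_mul_comm, trace_mul_comm]
  have e10 : (x.C * P * v.Cᵀ).trace = ((x.C * P)ᵀ * v.C).trace := by
    rw [trace_transpose_mul_comm, trace_mul_comm]
  have e11 : (v.C * P * x.Cᵀ).trace = ((x.C * P)ᵀ * v.C).trace := by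
    rw [trace_transpose_mul_comm, trace_mul_comm, ← trace_transpose]
    simp only [transpose_mul, transpose_transpose, hPt]
    rw [trace_mul_comm, ← Matrix.mul_assoc, trace_mul_comm, ← Matrix.mul_assoc]
  rw [gramS]
  simp only [transpose_add, transpose_sub, Matrix.add_mul, Matrix.sub_mul, trace_add, trace_sub,
    e1, e2, d1, e3, e4, e5, e6, e7, e8, e9, e10, e11] at d2 ⊢
  linarith

end

/-! ### Riemannian gradient and Hessian -/

noncomputable section

variable {n r m p : ℕ} {At : Matrix (Fin n) (Fin n) ℝ} {Bt : Matrix (Fin n) (Fin m) ℝ}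
  {Ct : Matrix (Fin p) (Fin n) ℝ} {x : PHSpace r m p}

theorem skPart_smul (c : ℝ) (M : Matrix (Fin r) (Fin r) ℝ) : skPart (c • M) = c • skPart M := by
  simp only [skPart, transpose_smul, ← smul_sub, smul_comm c]

theorem symPart_smul (c : ℝ) (M : Matrix (Fin r) (Fin r) ℝ) : symPart (c • M) = c • symPart M := by
  simp only [symPart, transpose_smul, ← smul_add, smul_comm c]

theorem transpose_symPart (M : Matrix (Fin r) (Fin r) ℝ) : (symPart M)ᵀ = symPart M := by
  simp [symPart, add_comm]

theorem symPart_eq_self {M : Matrix (Fin r) (Fin r) ℝ} (hM : Mᵀ = M) : symPart M = M := by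
  rw [symPart, hM]
  module

theorem symPart_mul_symPart_mul {R : Matrix (Fin r) (Fin r) ℝ} (hR : Rᵀ = R)
    (S : Matrix (Fin r) (Fin r) ℝ) : symPart (R * symPart S * R) = R * symPart S * R :=
  symPart_eq_self (by simp only [transpose_mul, transpose_symPart, hR, Matrix.mul_assoc])

/-- Symmetric and skew matrices are orthogonal for the trace pairing, so a skew direction sees only
the skew part. -/
theorem trace_transpose_skPart_mul {K : Matrix (Fin r) (Fin r) ℝ} (hK : Kᵀ = -K)
    (M : Matrix (Fin r) (Fin r) ℝ) : ((skPart M)ᵀ * K).trace = (Mᵀ * K).trace := by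
  have h : (M * K).trace = -(Mᵀ * K).trace := by
    rw [trace_transpose_mul_comm, hK, Matrix.neg_mul, trace_neg, trace_mul_comm, neg_neg]
  simp only [skPart, transpose_smul, transpose_sub, transpose_transpose, Matrix.smul_mul,
    Matrix.sub_mul, trace_smul, trace_sub, h, smul_eq_mul]
  ring

theorem trace_symPart_mul {K : Matrix (Fin r) (Fin r) ℝ} (hK : Kᵀ = K)
    (M : Matrix (Fin r) (Fin r) ℝ) : (symPart M * K).trace = (Mᵀ * K).trace := by
  have h : (M * K).trace = (Mᵀ * K).trace := by
    rw [trace_transpose_mul_comm, hK, trace_mul_comm]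
  simp only [symPart, Matrix.smul_mul, Matrix.add_mul, trace_smul, trace_add, h, smul_eq_mul]
  ring

/-- The Riemannian gradient of the objective function, as an explicit vector field. -/
def gradField (At : Matrix (Fin n) (Fin n) ℝ) (Bt : Matrix (Fin n) (Fin m) ℝ)
    (Ct : Matrix (Fin p) (Fin n) ℝ) (x : PHSpace r m p) : PHSpace r m p :=
  PHSpace.ofMatrices ((2 : ℝ) • gramS At Bt Ct x,
    (-2 : ℝ) • (x.R * symPart (gramS At Bt Ct x) * x.R),
    (2 : ℝ) • (gramQ x * x.B + (gramY At Ct x)ᵀ * Bt),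
    (2 : ℝ) • (x.C * gramP x - Ct * gramX At Bt x))

theorem J_gradField : (gradField At Bt Ct x).J = (2 : ℝ) • skPart (gramS At Bt Ct x) :=
  skPart_smul _ _

theorem R_gradField :
    (gradField At Bt Ct x).R = (-2 : ℝ) • (x.R * symPart (gramS At Bt Ct x) * x.R) := by
  rw [gradField, PHSpace.R_ofMatrices, symPart_smul, symPart_mul_symPart_mul x.transpose_R]

/-- The metric pairs the `R` component `η` through `R⁻¹ η R⁻¹`, so the Euclidean gradient `-2 sym(QP
+ YᵀX)` gets multiplied by `R` on both sides; the other factors are Euclidean. -/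
theorem grad_objective (hAt : IsDissipative At) (hx : x ∈ PHManifold r m p) :
    (phMetric r m p).grad (objective At Bt Ct) x = gradField At Bt Ct x := by
  rw [RiemannianMetricOn.grad, eq_comm, RiemannianMetricOn.eq_sharp_iff _ hx]
  intro w
  have hu : IsUnit x.R.det := (PosDef.det_pos hx).ne'.isUnit
  have hR : x.R⁻¹ * (gradField At Bt Ct x).R * x.R⁻¹ = (-2 : ℝ) • symPart (gramS At Bt Ct x) := by
    rw [R_gradField, Matrix.mul_smul, Matrix.smul_mul, Matrix.mul_assoc x.R,
      nonsing_inv_mul_cancel_left _ _ hu, mul_nonsing_inv_cancel_right _ _ hu]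
  rw [fderiv_objective hAt hx]
  refine (phForm_apply _ _ _).trans ?_
  rw [hR, J_gradField, transpose_smul, Matrix.smul_mul, trace_smul, Matrix.smul_mul, trace_smul,
    trace_transpose_skPart_mul w.transpose_J, trace_symPart_mul w.transpose_R]
  simp only [gradField, PHSpace.B_ofMatrices, PHSpace.C_ofMatrices, transpose_smul,
    Matrix.smul_mul, trace_smul, smul_eq_mul, Matrix.mul_sub, trace_sub]
  ring

section Smooth

open PHSpace

theorem ContDiffAt.symPart {M : PHSpace r m p → Matrix (Fin r) (Fin r) ℝ}
    (hM : ContDiffAt ℝ ∞ M x) : ContDiffAt ℝ ∞ (fun y => _root_.symPart (M y)) x :=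
  (hM.add hM.matTranspose).const_smul (1 / 2 : ℝ)

theorem HasDerivAt.symPart {M : ℝ → Matrix (Fin r) (Fin r) ℝ} {M' : Matrix (Fin r) (Fin r) ℝ}
    {t : ℝ} (hM : HasDerivAt M M' t) :
    HasDerivAt (fun u => _root_.symPart (M u)) (_root_.symPart M') t :=
  (hM.add hM.matTranspose).const_smul (1 / 2 : ℝ)

theorem contDiffAt_gramS (hAt : IsDissipative At) (hx : x ∈ PHManifold r m p) :
    ContDiffAt ℝ ∞ (gramS At Bt Ct : PHSpace r m p → _) x :=
  ((contDiffAt_gramQ hx).matMul (contDiffAt_gramP hx)).add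
    ((contDiffAt_gramY hAt hx).matTranspose.matMul (contDiffAt_gramX hAt hx))

theorem contDiffAt_gradField (hAt : IsDissipative At) (hx : x ∈ PHManifold r m p) :
    ContDiffAt ℝ ∞ (gradField At Bt Ct : PHSpace r m p → _) x := by
  have hS := contDiffAt_gramS (Bt := Bt) (Ct := Ct) hAt hx
  have hR := (contDiff_R (r := r) (m := m) (p := p)).contDiffAt (x := x)
  exact contDiffAt_ofMatrices (hS.const_smul (2 : ℝ))
    (((hR.matMul hS.symPart).matMul hR).const_smul (-2 : ℝ))
    ((((contDiffAt_gramQ hx).matMul contDiff_B.contDiffAt).add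
      ((contDiffAt_gramY hAt hx).matTranspose.matMul contDiffAt_const)).const_smul (2 : ℝ))
    (((contDiff_C.contDiffAt.matMul (contDiffAt_gramP hx)).sub
      (contDiffAt_const.matMul (contDiffAt_gramX hAt hx))).const_smul (2 : ℝ))

theorem hess_objective (hAt : IsDissipative At) (hx : x ∈ PHManifold r m p) {v : PHSpace r m p}
    {P' Q' : Matrix (Fin r) (Fin r) ℝ} {X' Y' : Matrix (Fin n) (Fin r) ℝ}
    (h : SolvesDerivGramEqs At Bt Ct x v (gramP x) (gramQ x) (gramX At Bt x) (gramY At Ct x)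
      P' Q' X' Y') {N : Matrix (Fin r) (Fin r) ℝ}
    (hN : N = Q' * gramP x + gramQ x * P' + Y'ᵀ * gramX At Bt x + (gramY At Ct x)ᵀ * X') :
    (phMetric r m p).hess (objective At Bt Ct) x v = PHSpace.ofMatrices ((2 : ℝ) • N,
      (-2 : ℝ) • (x.R * symPart N * x.R)
        - (2 : ℝ) • symPart (v.R * symPart (gramS At Bt Ct x) * x.R),
      (2 : ℝ) • (Q' * x.B + gramQ x * v.B + Y'ᵀ * Bt),
      (2 : ℝ) • (v.C * gramP x + x.C * P' - Ct * X')) := by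
  obtain ⟨dP, dQ, dX, dY⟩ := hasDerivAt_gram hAt hx h
  have dR := hasDerivAt_R x v
  have dS : HasDerivAt (fun t : ℝ => gramS At Bt Ct (x + t • v)) N 0 := by
    have := (dQ.matMul dP).add (dY.matTranspose.matMul dX)
    simp only [zero_smul, add_zero, ← add_assoc] at this
    rw [hN]
    exact this
  have d := hasDerivAt_ofMatrices (dS.const_smul (2 : ℝ))
    (((dR.matMul dS.symPart).matMul dR).const_smul (-2 : ℝ))
    (((dQ.matMul (hasDerivAt_B x v)).add
      (dY.matTranspose.matMul (hasDerivAt_const (0 : ℝ) Bt))).const_smul (2 : ℝ))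
    ((((hasDerivAt_C x v).matMul dP).sub
      ((hasDerivAt_const (0 : ℝ) Ct).matMul dX)).const_smul (2 : ℝ))
  simp only [zero_smul, add_zero, Matrix.zero_mul, Matrix.mul_zero, zero_add] at d
  -- The gradient is known only on the manifold; openness makes the identity local, which is enough
  -- to differentiate it at `x`.
  have hgrad : (phMetric r m p).grad (objective At Bt Ct) =ᶠ[nhds x] gradField At Bt Ct := by
    filter_upwards [(isOpen_phManifold r m p).mem_nhds hx] with y hy using grad_objective hAt hy
  have hu : IsUnit x.R.det := (PosDef.det_pos hx).ne'.isUnit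
  rw [RiemannianMetricOn.hess, RiemannianMetricOn.leviCivita, hgrad.fderiv_eq, hgrad.eq_of_nhds,
    christoffel_phMetric hx, (hasDerivAt_line v (contDiffAt_gradField hAt hx)).unique d, ← map_add]
  set S := gramS At Bt Ct x
  -- With `S' = sym S` the Christoffel term equals `v.R S' R + R S' v.R`, while the product rule
  -- contributes `-2` times this sum. What remains is `-2 sym(v.R S' R)`.
  have e1 : v.R * x.R⁻¹ * (gradField At Bt Ct x).R = (-2 : ℝ) • (v.R * symPart S * x.R) := by
    rw [R_gradField, Matrix.mul_smul, Matrix.mul_assoc v.R, Matrix.mul_assoc x.R,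
      nonsing_inv_mul_cancel_left _ _ hu, Matrix.mul_assoc]
  have e2 : (gradField At Bt Ct x).R * x.R⁻¹ * v.R = (-2 : ℝ) • (x.R * symPart S * v.R) := by
    rw [R_gradField, Matrix.smul_mul, Matrix.smul_mul, mul_nonsing_inv_cancel_right _ _ hu]
  have e3 : symPart (v.R * symPart S * x.R)
      = (1 / 2 : ℝ) • (v.R * symPart S * x.R + x.R * symPart S * v.R) := by
    rw [symPart]
    simp only [transpose_mul, transpose_symPart, x.transpose_R, v.transpose_R, Matrix.mul_assoc]
  rw [e1, e2, e3]
  congr 1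
  refine Prod.ext ?_ (Prod.ext ?_ (Prod.ext ?_ ?_))
  · simp
  · simp only [Prod.fst_add, Prod.snd_add, Matrix.add_mul]
    module
  · simp only [Prod.fst_add, Prod.snd_add, add_zero]
  · simp only [Prod.snd_add, add_zero]

end Smooth

theorem R_hess_eq (v : PHSpace r m p) (N S : Matrix (Fin r) (Fin r) ℝ) :
    symPart ((-2 : ℝ) • (x.R * symPart N * x.R) - (2 : ℝ) • symPart (v.R * symPart S * x.R))
      = (-2 : ℝ) • (x.R * symPart N * x.R) - (2 : ℝ) • symPart (v.R * symPart S * x.R) :=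
  symPart_eq_self (by
    simp only [transpose_sub, transpose_smul, transpose_symPart, transpose_mul, x.transpose_R,
      Matrix.mul_assoc])

end

theorem mainTheorem3 {n r m p : ℕ}
    (A : Matrix (Fin n) (Fin n) ℝ) (B : Matrix (Fin n) (Fin m) ℝ) (C : Matrix (Fin p) (Fin n) ℝ)
    (hA : IsStableMatrix A)
    (Jt Rt : Matrix (Fin n) (Fin n) ℝ) (Bt : Matrix (Fin n) (Fin m) ℝ)
    (Ct : Matrix (Fin p) (Fin n) ℝ) (hform : IsDissipativeForm A B C Jt Rt Bt Ct) :
    ContDiffOn ℝ ∞ (objective (r := r) A B C) (PHManifold r m p) ∧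
    ∀ x ∈ PHManifold r m p,
      Integrable (fun t : ℝ => frobNorm (errorTransfer A B C x (Complex.I * t)) ^ 2) ∧
      (∃! S : Matrix (Fin r) (Fin r) ℝ × Matrix (Fin r) (Fin r) ℝ ×
          Matrix (Fin n) (Fin r) ℝ × Matrix (Fin n) (Fin r) ℝ,
        SolvesGramEqs (Jt - Rt) Bt Ct x S.1 S.2.1 S.2.2.1 S.2.2.2) ∧
      ∀ (P Q : Matrix (Fin r) (Fin r) ℝ) (X Y : Matrix (Fin n) (Fin r) ℝ),
        SolvesGramEqs (Jt - Rt) Bt Ct x P Q X Y →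
        (((phMetric r m p).grad (objective A B C) x).J = (2 : ℝ) • skPart (Q * P + Yᵀ * X) ∧
          ((phMetric r m p).grad (objective A B C) x).R
            = (-2 : ℝ) • (x.R * symPart (Q * P + Yᵀ * X) * x.R) ∧
          ((phMetric r m p).grad (objective A B C) x).B = (2 : ℝ) • (Q * x.B + Yᵀ * Bt) ∧
          ((phMetric r m p).grad (objective A B C) x).C = (2 : ℝ) • (x.C * P - Ct * X)) ∧
        ∀ v : PHSpace r m p,
          (∃! S : Matrix (Fin r) (Fin r) ℝ × Matrix (Fin r) (Fin r) ℝ ×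
              Matrix (Fin n) (Fin r) ℝ × Matrix (Fin n) (Fin r) ℝ,
            SolvesDerivGramEqs (Jt - Rt) Bt Ct x v P Q X Y S.1 S.2.1 S.2.2.1 S.2.2.2) ∧
          ∀ (P' Q' : Matrix (Fin r) (Fin r) ℝ) (X' Y' : Matrix (Fin n) (Fin r) ℝ),
            SolvesDerivGramEqs (Jt - Rt) Bt Ct x v P Q X Y P' Q' X' Y' →
            ((phMetric r m p).hess (objective A B C) x v).J
                = (2 : ℝ) • skPart (Q' * P + Q * P' + Y'ᵀ * X + Yᵀ * X') ∧
            ((phMetric r m p).hess (objective A B C) x v).R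
                = (-2 : ℝ) • (x.R * symPart (Q' * P + Q * P' + Y'ᵀ * X + Yᵀ * X') * x.R)
                  - (2 : ℝ) • symPart (v.R * symPart (Q * P + Yᵀ * X) * x.R) ∧
            ((phMetric r m p).hess (objective A B C) x v).B
                = (2 : ℝ) • (Q' * x.B + Q * v.B + Y'ᵀ * Bt) ∧
            ((phMetric r m p).hess (objective A B C) x v).C
                = (2 : ℝ) • (v.C * P + x.C * P' - Ct * X') := by
  -- The objective depends on the full system only through its transfer function, so everything is
  -- transferred to the dissipative realization.
  have hAt : IsDissipative (Jt - Rt) := .sub_of_skew hform.skew hform.posDef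
  have hG := transferFunction_eq_of_isDissipativeForm hform
  have herr : errorTransfer (r := r) A B C = errorTransfer (Jt - Rt) Bt Ct := by
    funext x s
    rw [errorTransfer, errorTransfer, hG]
  have hobj : objective (r := r) A B C = objective (Jt - Rt) Bt Ct := by
    funext x
    rw [objective, objective, herr]
  rw [hobj, herr]
  refine ⟨fun x hx => (contDiffAt_objective hAt hx).contDiffWithinAt, fun x hx =>
    ⟨(integrable_and_objective_eq_gram hAt hx).1,
      ⟨(gramP x, gramQ x, gramX (Jt - Rt) Bt x, gramY (Jt - Rt) Ct x),
        (solvesGramEqs_iff hAt hx).2 ⟨rfl, rfl, rfl, rfl⟩, ?_⟩, ?_⟩⟩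
  · rintro ⟨P, Q, X, Y⟩ h
    obtain ⟨rfl, rfl, rfl, rfl⟩ := (solvesGramEqs_iff hAt hx).1 h
    rfl
  · intro P Q X Y h
    obtain ⟨rfl, rfl, rfl, rfl⟩ := (solvesGramEqs_iff hAt hx).1 h
    rw [grad_objective hAt hx]
    refine ⟨⟨J_gradField, R_gradField, rfl, rfl⟩, fun v => ⟨⟨(_, _, _, _),
      (solvesDerivGramEqs_iff hAt hx).2 ⟨rfl, rfl, rfl, rfl⟩, ?_⟩, ?_⟩⟩
    · rintro ⟨P', Q', X', Y'⟩ h'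
      obtain ⟨rfl, rfl, rfl, rfl⟩ := (solvesDerivGramEqs_iff hAt hx).1 h'
      rfl
    · intro P' Q' X' Y' h'
      rw [hess_objective hAt hx h' rfl]
      exact ⟨skPart_smul _ _, R_hess_eq v _ _, rfl, rfl⟩
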